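/- Let $n\ge 0$ and $d\ge 1$ be integers with $d\mid n$. A $d$-divisible ordered set partition of $[n]=\{1,\dots,n\}$ is a sequence $\omega=(B_1,\dots,B_k)$ of nonempty, pairwise disjoint subsets (blocks) with union $[n]$ and with $d\mid \#B_i$ for all $i$; for $n=0$ there are, by convention, none. They are partially ordered by letting $(B_1,\dots,B_k)$ be covered by every sequence $(B_1,\dots,B_{i-1},B_i\uplus B_{i+1},B_{i+2},\dots,B_k)$, $1\le i<k$, and extending by transitivity. Let $\Omega_n^{(d)}$ be this poset with a least element $\hat 0$ added. For a finite poset $P$ with $\hat 0$ and $\hat 1$, a linear ordering $a_1,\dots,a_t$ of its atoms is a recursive atom ordering (RAO), defined recursively, if (R1) for all $j$, the interval $[a_j,\hat 1]$ admits an RAO in which the atoms of $[a_j,\hat 1]$ that cover some $a_i$ with $i<j$ come first; and (R2) for all $i<k$ and every $y$ with $a_i,a_k<y$ there are $j<k$ and $x\in P$ such that $x$ covers both $a_j$ and $a_k$, and $x\le y$. **Theorem.** The poset $\Omega_n^{(d)}$ has an RAO. More precisely, the following ordering of its atoms is an RAO: compare two atoms at the first position in which their blocks differ, and compare these two blocks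 lexicographically after writing each in decreasing order. When $d=1$, atoms are permutations of $[n]$, and this is the lexicographic order on permutations in one-line notation. Moreover, $\Omega_n^{(d)}$ is (graded and) CL-shellable, and it is Cohen–Macaulay over every commutative ring $R$. Here a finite bounded graded poset $P$ is CL-shellable if its edges in maximal chains can be labelled by elements of some partially ordered set, the label of an edge in a maximal chain depending only on the part of the chain from $\hat 0$ up to and including that edge, in such a way that for every interval $[x,y]$ and every maximal chain $r$ of $[\hat 0,x]$ there is exactly one maximal chain of $[x,y]$ whose word of labels (read as a continuation of $r$) is strictly increasing, and this word lexicographically precedes the words of all other maximal chains of $[x,y]$. The poset $P$ is Cohen–Macaulay over $R$ if, for all $x<y$ in $P$, the reduced simplicial homology with coefficients in $R$ of the order complex of the open interval $(x,y)$ vanishes in all degrees below the dimension of this complex. -/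

import Mathlib

namespace OrdPart

section Posets

variable {P : Type*} [PartialOrder P]

/-- `SatChain x y c`: the list `x :: c` is a saturated (unrefinable) chain
`x ⋖ c₁ ⋖ ⋯ ⋖ cₖ = y`, i.e. a maximal chain of the interval `[x, y]`.
The starting point `x` is not repeated in `c`. -/
def SatChain (x y : P) (c : List P) : Prop :=
  List.IsChain (· ⋖ ·) (x :: c) ∧ (x :: c).getLast (List.cons_ne_nil x c) = y

/-- A poset with `0̂` is graded if it has a `1̂` and, for every `y`, all maximal chains
of `[0̂, y]` have the same length. -/
structure IsGradedPoset (P : Type*) [PartialOrder P] [OrderBot P] : Prop where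
  exists_top : ∃ t : P, IsTop t
  length_eq : ∀ (y : P) (c c' : List P),
    SatChain ⊥ y c → SatChain ⊥ y c' → c.length = c'.length

/-- `IsRAO x L`: the list `L` is a recursive atom ordering of the upper interval `[x, 1̂]`
of a finite poset with `1̂`. The atoms of `[x, 1̂]` are the elements covering `x`. For each `j`
the atoms of `[L[j], 1̂]` are listed as `first j ++ rest j`, where `first j` consists of
those that cover some earlier `L[i]`, and `rest j` of the others. -/
inductive IsRAO : P → List P → Prop
  | intro (x : P) (L : List P)
      (nodup : L.Nodup)
      (mem_iff : ∀ a, a ∈ L ↔ x ⋖ a)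
      (first rest : Fin L.length → List P)
      (rao : ∀ j : Fin L.length, IsRAO (L.get j) (first j ++ rest j))
      (covers_first : ∀ j, ∀ b ∈ first j, ∃ i, i < j ∧ L.get i ⋖ b)
      (not_covers_rest : ∀ j, ∀ b ∈ rest j, ¬ ∃ i, i < j ∧ L.get i ⋖ b)
      (common_cover : ∀ i k : Fin L.length, i < k → ∀ y, L.get i < y → L.get k < y →
        ∃ j, j < k ∧ ∃ z, L.get j ⋖ z ∧ L.get k ⋖ z ∧ z ≤ y) :
      IsRAO x L

/-- The word of labels read along the chain `c`, continuing the saturated chain `r` that starts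
at `0̂` (with `0̂` omitted from `r`). -/
def labelWord {Λ : Type*} (lab : List P → P → Λ) : List P → List P → List Λ
  | _, [] => []
  | r, y :: c => lab r y :: labelWord lab (r ++ [y]) c

/-- Chain-edge labelings in the sense of Björner and Wachs: the label of an edge `x ⋖ y` of a
maximal chain depends only on the part of the maximal chain up to that edge. It is written
`lab r y`, where `r` is the saturated chain from `0̂` to `x` (with `0̂` omitted).
The labeling is a CL-labeling if in every rooted interval `[x, y]_r` there is a unique maximal
chain with increasing label word, and its word is lexicographically smaller than the
words of all the other maximal chains of the rooted interval. -/
def IsCLLabeling [OrderBot P] {Λ : Type*} [PartialOrder Λ] (lab : List P → P → Λ) : Prop :=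
  ∀ (x y : P) (r : List P), SatChain ⊥ x r → x ≤ y →
    ∃ c, SatChain x y c ∧ List.IsChain (· < ·) (labelWord lab r c) ∧
      ∀ c', SatChain x y c' → c' ≠ c →
        ¬ List.IsChain (· < ·) (labelWord lab r c') ∧
        List.Lex (· < ·) (labelWord lab r c) (labelWord lab r c')

/-- A (finite, bounded) graded poset is CL-shellable if it admits a CL-labeling. -/
def CLShellable (P : Type*) [PartialOrder P] [OrderBot P] : Prop :=
  IsGradedPoset P ∧
    ∃ (Λ : Type) (_ : PartialOrder Λ) (lab : List P → P → Λ), IsCLLabeling lab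

/-- Chains `c₀ < ⋯ < c_{k-1}` with `k` elements in the open interval `(x, y)`: the faces of
dimension `k - 1` of its order complex (for `k = 0`, the empty face). -/
def OpenChain (x y : P) (k : ℕ) : Type _ :=
  {c : Fin k → P // StrictMono c ∧ ∀ i, x < c i ∧ c i < y}

/-- The face obtained by deleting the vertex number `i`. -/
def OpenChain.face {x y : P} {k : ℕ} (c : OpenChain x y (k + 1)) (i : Fin (k + 1)) :
    OpenChain x y k :=
  ⟨c.1 ∘ i.succAbove, c.2.1.comp (Fin.strictMono_succAbove i), fun j => c.2.2 (i.succAbove j)⟩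

/-- The boundary map of the augmented chain complex of the order complex of `(x, y)`, from the
free module on the faces with `k + 1` vertices to the free module on those with `k` vertices. -/
noncomputable def boundary (R : Type*) [CommRing R] (x y : P) (k : ℕ) :
    (OpenChain x y (k + 1) →₀ R) →ₗ[R] (OpenChain x y k →₀ R) :=
  Finsupp.linearCombination R fun c =>
    ∑ i : Fin (k + 1), Finsupp.single (c.face i) ((-1 : R) ^ (i : ℕ))

/-- The cycles of dimension `k - 1`. -/
noncomputable def cycles (R : Type*) [CommRing R] (x y : P) :
    (k : ℕ) → Submodule R (OpenChain x y k →₀ R)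
  | 0 => ⊤
  | k + 1 => LinearMap.ker (boundary R x y k)

/-- The reduced simplicial homology of dimension `k - 1` (so dimension `-1` for `k = 0`), with
coefficients in `R`, of the order complex of the open interval `(x, y)` is zero: every cycle is
a boundary. -/
def HomologyVanishes (R : Type*) [CommRing R] (x y : P) (k : ℕ) : Prop :=
  cycles R x y k ≤ LinearMap.range (boundary R x y k)

/-- A (finite, bounded) graded poset is Cohen-Macaulay over `R` if, for all `x < y`, the reduced
homology of the order complex of the open interval `(x, y)` vanishes in every dimension below
the dimension of that complex. Dimension `k - 1` is below the dimension of the complex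
exactly if there is a face with `k + 1` vertices. -/
def CohenMacaulay (R : Type*) [CommRing R] (P : Type*) [PartialOrder P] [OrderBot P] : Prop :=
  IsGradedPoset P ∧
    ∀ (x y : P), x < y → ∀ k : ℕ, Nonempty (OpenChain x y (k + 1)) →
      HomologyVanishes R x y k

end Posets

/-- The `d`-divisible ordered set partitions of `[n]` (modelled as `Fin n`). By convention there
are none for `n = 0`, so the sequence of blocks is required to be nonempty. -/
@[ext]
structure DivPartition (n d : ℕ) where
  blocks : List (Finset (Fin n))
  ne_nil : blocks ≠ []
  block_nonempty : ∀ B ∈ blocks, B.Nonempty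
  disjoint : blocks.Pairwise Disjoint
  cover : ∀ i : Fin n, ∃ B ∈ blocks, i ∈ B
  dvd_card : ∀ B ∈ blocks, d ∣ B.card

namespace DivPartition

variable {n d : ℕ}

/-- `ψ` arises from `ω` by merging two adjacent blocks. -/
def Merge (ω ψ : DivPartition n d) : Prop :=
  ∃ (l₁ : List (Finset (Fin n))) (B C : Finset (Fin n)) (l₂ : List (Finset (Fin n))),
    ω.blocks = l₁ ++ B :: C :: l₂ ∧ ψ.blocks = l₁ ++ (B ∪ C) :: l₂

theorem eq_or_length_lt {ω ψ : DivPartition n d} (h : Relation.ReflTransGen Merge ω ψ) :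
    ω = ψ ∨ ψ.blocks.length < ω.blocks.length := by
  induction h with
  | refl => exact Or.inl rfl
  | tail _ hs ih =>
    obtain ⟨l₁, B, C, l₂, h1, h2⟩ := hs
    right
    rcases ih with rfl | ih
    · simp [h1, h2]
    · refine lt_trans ?_ ih
      simp [h1, h2]

/-- The order generated by merging adjacent blocks. -/
instance : PartialOrder (DivPartition n d) where
  le := Relation.ReflTransGen Merge
  le_refl _ := Relation.ReflTransGen.refl
  le_trans _ _ _ := Relation.ReflTransGen.trans
  le_antisymm a b hab hba := by
    rcases eq_or_length_lt hab with h | h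
    · exact h
    · rcases eq_or_length_lt hba with h' | h'
      · exact h'.symm
      · exact absurd h (lt_asymm h')

end DivPartition

/-- The poset of `d`-divisible ordered set partitions of `[n]` with a least element added. -/
abbrev Omega (n d : ℕ) : Type := WithBot (DivPartition n d)

/-- The sequence of blocks of an ordered set partition, each block written as a list in decreasing
order (and the empty sequence for the added least element). -/
def decBlocks {n d : ℕ} : Omega n d → List (List (Fin n))
  | ⊥ => []
  | (ω : DivPartition n d) => ω.blocks.map fun B => B.sort (· ≥ ·)

/-- Comparison at the first block in which two elements differ, where blocks, written
in decreasing order, are compared lexicographically. -/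
def BlockLexLT {n d : ℕ} (a b : Omega n d) : Prop :=
  List.Lex (List.Lex (· < ·)) (decBlocks a) (decBlocks b)

/-- Lexicographic comparison of the words obtained by writing all blocks in a row. If all blocks
are singletons, these words are the one-line notations of permutations. -/
def WordLexLT {n d : ℕ} (a b : Omega n d) : Prop :=
  List.Lex (· < ·) (decBlocks a).flatten (decBlocks b).flatten

end OrdPart

/-!
An ordered set partition `(B₁, …, Bₖ)` is the same as the chain of its initial unions
`B₁ ∪ ⋯ ∪ Bᵢ`, `1 ≤ i < k`, and merging adjacent blocks removes an element from this chain
(`OrdPart.DivPartition.initialUnions`, `OrdPart.DivPartition.le_iff`). Hence every upper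
interval `[ω, 1̂]` with `ω ≠ 0̂` is Boolean, and any ordering of its atoms is a recursive atom
ordering (`OrdPart.isRAO_coe`). This leaves only the condition on common covers of two atoms
`a` before `b` of the whole poset, with a common upper bound `ψ`. Some two adjacent blocks
`B, C` of `b` that are merged in `ψ` form a descent, i.e. not all elements of `B` are smaller than
those of `C`: otherwise the first block of `b` that differs from the one in `a` would consist of the
smallest elements available, and `b` would come before `a` (`OrdPart.exists_descent`). Replacing `B`
by the `d` smallest elements of `B ∪ C`, and `C` by the others, gives an earlier atom, and
merging `B` and `C` a common cover of it and `b` below `ψ` (`OrdPart.exists_earlier_atom`).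

The other claims hold for every graded poset with a recursive atom ordering.
For CL-shellability (`OrdPart.IsRAO.clShellable`) the edges are labelled by integers, increasing
along the atom ordering of each rooted upper interval `[x, 1̂]`. The labels of the atoms
of `[aⱼ, 1̂]` that cover an earlier `aᵢ` are below the label of the edge to `aⱼ`, those of the
others above it. Then the increasing chain of `[x, y]` is the one that always goes to the first
possible atom.
For the Cohen-Macaulay property (`OrdPart.IsRAO.cohenMacaulay`) the open interval `(x, y)` is built
up by adding the sets `[aⱼ, y)` in the order of the atoms. The order complex of `[aⱼ, y)` is a
cone, and its part already present is generated by an initial segment of an atom ordering of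
`[aⱼ, 1̂]`, so induction and the Mayer-Vietoris argument apply (`OrdPart.IsRAO.acyclicAt`).
-/

namespace OrdPart

section Generic

variable {P : Type*} [PartialOrder P]

/-! ### Saturated chains and recursive atom orderings -/

theorem satChain_nil {x y : P} : SatChain x y [] ↔ x = y := by
  simp [SatChain]

theorem satChain_cons {x y a : P} {c : List P} :
    SatChain x y (a :: c) ↔ x ⋖ a ∧ SatChain a y c := by
  simp [SatChain, List.isChain_cons_cons, and_assoc]

theorem SatChain.le {x y : P} {c : List P} (h : SatChain x y c) : x ≤ y := by
  induction c generalizing x with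
  | nil => exact (satChain_nil.1 h).le
  | cons a c ih =>
    obtain ⟨h1, h2⟩ := satChain_cons.1 h
    exact h1.le.trans (ih h2)

theorem SatChain.eq_nil {x : P} {c : List P} (h : SatChain x x c) : c = [] := by
  cases c with
  | nil => rfl
  | cons a c =>
    obtain ⟨h1, h2⟩ := satChain_cons.1 h
    exact absurd h2.le h1.lt.not_ge

theorem IsRAO.mem_iff {x : P} {L : List P} (h : IsRAO x L) (a : P) : a ∈ L ↔ x ⋖ a := by
  cases h with
  | intro _ _ nodup mem_iff => exact mem_iff a

/-- A poset with a recursive atom ordering has one on each of its upper intervals. -/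
theorem IsRAO.exists_of_le [IsStronglyAtomic P] {x z : P} {L : List P} (h : IsRAO x L)
    (hz : x ≤ z) : ∃ L', IsRAO z L' := by
  induction h with
  | intro x L nodup mem_iff first rest rao cf nr cc ih =>
    rcases hz.eq_or_lt with rfl | hlt
    · exact ⟨L, .intro x L nodup mem_iff first rest rao cf nr cc⟩
    · obtain ⟨a, ha, haz⟩ := exists_covBy_le_of_lt hlt
      obtain ⟨j, rfl⟩ := List.mem_iff_get.1 ((mem_iff a).2 ha)
      exact ih j haz

theorem CovBy.not_le_of_ne {x a b : P} (ha : x ⋖ a) (hb : x ⋖ b) (hne : a ≠ b) : ¬ a ≤ b :=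
  fun h => hb.2 ha.lt (h.lt_of_ne hne)

/-! ### From recursive atom orderings to chain-edge labelings -/

/-- The condition on a chain-edge labeling to be a CL-labeling, for the rooted intervals
in the upper interval of `x`, where the roots are saturated chains starting at `x`. -/
def IsCLLabelingFrom {Λ : Type*} [PartialOrder Λ] (x : P) (lab : List P → P → Λ) : Prop :=
  ∀ (z y : P) (r : List P), SatChain x z r → z ≤ y →
    ∃ c, SatChain z y c ∧ List.IsChain (· < ·) (labelWord lab r c) ∧
      ∀ c', SatChain z y c' → c' ≠ c →
        ¬ List.IsChain (· < ·) (labelWord lab r c') ∧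
        List.Lex (· < ·) (labelWord lab r c) (labelWord lab r c')

theorem labelWord_congr {Q Λ : Type*} {lab lab' : List Q → Q → Λ} {a : Q}
    (h : ∀ r b, lab (a :: r) b = lab' r b) (r c : List Q) :
    labelWord lab (a :: r) c = labelWord lab' r c := by
  induction c generalizing r with
  | nil => rfl
  | cons b c ih => simp [labelWord, h, ih]

theorem lex_head_le {a b : ℤ} {s t : List ℤ} (h : List.Lex (· < ·) (a :: s) (b :: t)) :
    a ≤ b := by
  cases h with
  | rel h => exact h.le
  | cons h => exact le_rfl

/-- The first label of the increasing chain is the smallest one among those of the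
first edges. -/
theorem IsCLLabelingFrom.head_le {x : P} {lab : List P → P → ℤ} (h : IsCLLabelingFrom x lab)
    {y a b : P} {c : List P} (hc : SatChain x y (a :: c))
    (hinc : List.IsChain (· < ·) (labelWord lab [] (a :: c))) (hb : x ⋖ b) (hby : b ≤ y) :
    lab [] a ≤ lab [] b := by
  obtain ⟨c₀, h0, -, h0lex⟩ := h x y [] (satChain_nil.2 rfl) hc.le
  have e : a :: c = c₀ := by
    by_contra hne
    exact (h0lex _ hc hne).1 hinc
  subst e
  obtain ⟨e, he, -⟩ := h b y [b] (satChain_cons.2 ⟨hb, satChain_nil.2 rfl⟩) hby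
  by_cases heq : b :: e = a :: c
  · simp only [List.cons.injEq] at heq
    rw [heq.1]
  · have := (h0lex _ (satChain_cons.2 ⟨hb, he⟩) heq).2
    simp only [labelWord] at this
    exact lex_head_le this

/-- The label of the atom number `i` when the first `f` of the atoms are to get labels
below `l` and the others labels above `l`. -/
def atomLabel (l : ℤ) (f i : ℕ) : ℤ := l + i - f + if i < f then 0 else 1

theorem atomLabel_lt {l : ℤ} {f i j : ℕ} (h : i < j) : atomLabel l f i < atomLabel l f j := by
  unfold atomLabel
  split_ifs <;> omega

/-- A recursive atom ordering gives a CL-labeling by integers. The induction needs control of the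
labels of the atoms relative to the label `l` of the edge that leads to `x`: an initial
segment of the ordering, later taken to be the atoms covering earlier ones, has labels
below `l` and creates a descent, the others have labels above `l`. -/
theorem IsRAO.exists_labeling {x : P} {L : List P} (h : IsRAO x L)
    [IsStronglyAtomic P] (l : ℤ) (first rest : List P) (hL : L = first ++ rest) :
    ∃ lab : List P → P → ℤ, (∀ a ∈ first, lab [] a < l) ∧ (∀ a ∈ rest, l < lab [] a) ∧
      IsCLLabelingFrom x lab := by
  classical
  induction h generalizing l first rest with
  | intro x L nodup mem_iff fst rst rao cf nr cc ih =>
    have cov : ∀ j, x ⋖ L.get j := fun j => (mem_iff _).1 (L.get_mem j)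
    choose labs hfst hrst hCL using
      fun j => ih j (atomLabel l first.length j) (fst j) (rst j) rfl
    let lab : List P → P → ℤ
      | [], a => atomLabel l first.length (L.idxOf a)
      | a :: r, b => if h : L.idxOf a < L.length then labs ⟨L.idxOf a, h⟩ r b else 0
    have lab_nil : ∀ j : Fin L.length, lab [] (L.get j) = atomLabel l first.length j := by
      intro j
      simp only [lab, List.get_idxOf nodup]
    have lab_cons : ∀ (j : Fin L.length) r b, lab (L.get j :: r) b = labs j r b := by
      intro j r b
      simp only [lab, List.get_idxOf nodup, j.2, dif_pos]
    have word : ∀ (j : Fin L.length) r c,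
        labelWord lab (L.get j :: r) c = labelWord (labs j) r c :=
      fun j => labelWord_congr (lab_cons j)
    refine ⟨lab, ?_, ?_, ?_⟩
    · intro a ha
      have : L.idxOf a < first.length := by
        rw [hL, List.idxOf_append_of_mem ha]
        exact List.idxOf_lt_length_iff.2 ha
      simp only [lab, atomLabel, this, if_true]
      omega
    · intro a ha
      have hna : a ∉ first := fun h =>
        (List.nodup_append.1 (hL ▸ nodup)).2.2 a h a ha rfl
      have : first.length ≤ L.idxOf a := by
        rw [hL, List.idxOf_append_of_notMem hna]
        omega
      simp only [lab, atomLabel, this.not_gt, if_false]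
      omega
    · intro z y r hr hzy
      cases r with
      | cons a r =>
        obtain ⟨hxa, har⟩ := satChain_cons.1 hr
        obtain ⟨j, rfl⟩ := List.mem_iff_get.1 ((mem_iff a).2 hxa)
        simpa only [word] using hCL j z y r har hzy
      | nil =>
        obtain rfl := satChain_nil.1 hr
        rcases hzy.eq_or_lt with rfl | hlt
        · refine ⟨[], satChain_nil.2 rfl, by simp [labelWord], fun c' hc' hne => ?_⟩
          exact absurd hc'.eq_nil hne
        have hex : ∃ i, ∃ hi : i < L.length, L.get ⟨i, hi⟩ ≤ y := by
          obtain ⟨a, ha, hay⟩ := exists_covBy_le_of_lt hlt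
          obtain ⟨j, rfl⟩ := List.mem_iff_get.1 ((mem_iff a).2 ha)
          exact ⟨j, j.2, hay⟩
        -- the increasing chain starts with the first atom below `y`
        obtain ⟨hi, hjy⟩ := Nat.find_spec hex
        have hmin : ∀ k : Fin L.length, L.get k ≤ y → Nat.find hex ≤ k := fun k hk =>
          Nat.find_min' hex ⟨k.2, hk⟩
        generalize hj : (⟨Nat.find hex, hi⟩ : Fin L.length) = j at *
        have hmin' : ∀ k : Fin L.length, L.get k ≤ y → j ≤ k := by
          intro k hk
          rw [← hj]
          exact hmin k hk
        obtain ⟨c, hc, hinc, hlex⟩ := hCL j (L.get j) y [] (satChain_nil.2 rfl) hjy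
        refine ⟨L.get j :: c, satChain_cons.2 ⟨cov j, hc⟩, ?_, ?_⟩
        · simp only [labelWord, List.nil_append, word, lab_nil]
          cases c with
          | nil => simp [labelWord]
          | cons b c =>
            simp only [labelWord] at hinc ⊢
            refine List.isChain_cons_cons.2 ⟨?_, hinc⟩
            obtain ⟨hjb, hby⟩ := satChain_cons.1 hc
            rcases List.mem_append.1 (((rao j).mem_iff b).2 hjb) with hb | hb
            · obtain ⟨i, hij, hib⟩ := cf j b hb
              exact absurd (hmin' i (hib.le.trans hby.le)) hij.not_ge
            · exact hrst j b hb
        · intro c' hc' hne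
          cases c' with
          | nil => exact absurd (satChain_nil.1 hc') hlt.ne
          | cons a c' =>
            obtain ⟨hxa, hac⟩ := satChain_cons.1 hc'
            obtain ⟨k, rfl⟩ := List.mem_iff_get.1 ((mem_iff a).2 hxa)
            have hjk := hmin' k hac.le
            simp only [labelWord, List.nil_append, word, lab_nil]
            rcases hjk.eq_or_lt with rfl | hjk
            · have hcc : c' ≠ c := fun h => hne (by rw [h])
              obtain ⟨h1, h2⟩ := hlex c' hac hcc
              exact ⟨fun h => h1 (by simpa using h.tail), .cons h2⟩
            · refine ⟨fun hinc' => ?_, .rel (atomLabel_lt hjk)⟩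
              -- an atom that covers an earlier one lies below `y` and forces a descent
              have hjk' : L.get j ≠ L.get k := fun h =>
                hjk.ne (List.nodup_iff_injective_get.1 nodup h)
              have hky : L.get k < y := hac.le.lt_of_ne fun h =>
                CovBy.not_le_of_ne (cov j) (cov k) hjk' (h ▸ hjy)
              have hjy' : L.get j < y := hjy.lt_of_ne fun h =>
                CovBy.not_le_of_ne (cov k) (cov j) hjk'.symm (h ▸ hky.le)
              obtain ⟨i, hik, b, hib, hkb, hby⟩ := cc j k hjk y hjy' hky
              have hbf : b ∈ fst k := by
                rcases List.mem_append.1 (((rao k).mem_iff b).2 hkb) with hb | hb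
                · exact hb
                · exact absurd ⟨i, hik, hib⟩ (nr k b hb)
              cases c' with
              | nil => exact absurd (satChain_nil.1 hac) hky.ne
              | cons e c' =>
                have htail : List.IsChain (· < ·) (labelWord (labs k) [] (e :: c')) := by
                  simpa using hinc'.tail
                have h1 := (hCL k).head_le hac htail hkb hby
                have h2 := hfst k b hbf
                simp only [labelWord] at hinc'
                have h3 := (List.isChain_cons_cons.1 hinc').1
                omega

/-- Björner and Wachs: a graded poset with a recursive atom ordering is CL-shellable. -/
theorem IsRAO.clShellable [OrderBot P] [IsStronglyAtomic P] {L : List P}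
    (h : IsRAO (⊥ : P) L) (hg : IsGradedPoset P) : CLShellable P := by
  obtain ⟨lab, -, -, hlab⟩ := h.exists_labeling 0 [] L rfl
  exact ⟨hg, ℤ, inferInstance, lab, hlab⟩

end Generic

section Homology

/-! ### Chains as lists -/

variable {P : Type*} (R : Type*) [CommRing R]

/-- Prepending the vertex `a` to all lists of a linear combination. -/
noncomputable def consMap (a : P) : (List P →₀ R) →ₗ[R] (List P →₀ R) :=
  Finsupp.lmapDomain R R (List.cons a)

/-- The boundary of a list of vertices, by recursion: `∂(a :: l) = l - a :: ∂l`. -/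
noncomputable def listBoundaryAux : List P → (List P →₀ R)
  | [] => 0
  | a :: l => Finsupp.single l 1 - consMap R a (listBoundaryAux l)

/-- The boundary map of the augmented ordered chain complex on the vertex set `P`, with all
dimensions put together in a single module. -/
noncomputable def listBoundary : (List P →₀ R) →ₗ[R] (List P →₀ R) :=
  Finsupp.linearCombination R (listBoundaryAux R)

variable {R}

theorem listBoundary_single (l : List P) (r : R) :
    listBoundary R (Finsupp.single l r) = r • listBoundaryAux R l := by
  simp [listBoundary, Finsupp.linearCombination_single]

theorem listBoundary_consMap (a : P) (z : List P →₀ R) :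
    listBoundary R (consMap R a z) = z - consMap R a (listBoundary R z) := by
  induction z using Finsupp.induction_linear with
  | zero => simp
  | add f g hf hg => simp only [map_add, hf, hg]; abel
  | single l r =>
    have : consMap R a (Finsupp.single l r) = Finsupp.single (a :: l) r := by
      simp [consMap, Finsupp.mapDomain_single]
    rw [this, listBoundary_single, listBoundary_single, listBoundaryAux, smul_sub, map_smul,
      Finsupp.smul_single_one]

theorem listBoundary_listBoundary (z : List P →₀ R) :
    listBoundary R (listBoundary R z) = 0 := by
  induction z using Finsupp.induction_linear with
  | zero => simp
  | add f g hf hg => simp only [map_add, hf, hg, add_zero]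
  | single l r =>
    rw [listBoundary_single, map_smul]
    suffices h : listBoundary R (listBoundaryAux R l) = 0 by rw [h, smul_zero]
    induction l with
    | nil => simp [listBoundaryAux]
    | cons a l ih =>
      rw [listBoundaryAux, map_sub, listBoundary_consMap, ih, listBoundary_single]
      simp

variable [PartialOrder P]

/-- The chains with `k` elements in `X`, as increasing lists. -/
def chainLists (X : Set P) (k : ℕ) : Set (List P) :=
  {l | l.length = k ∧ l.Pairwise (· < ·) ∧ ∀ p ∈ l, p ∈ X}

variable (R) in
/-- The module of `(k - 1)`-dimensional chains of the order complex of `X`. -/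
noncomputable def chainsIn (X : Set P) (k : ℕ) : Submodule R (List P →₀ R) :=
  Finsupp.supported R R (chainLists X k)

variable (R) in
/-- The reduced homology of the order complex of `X` vanishes in dimension `k - 1`. -/
def AcyclicAt (X : Set P) (k : ℕ) : Prop :=
  ∀ z ∈ chainsIn R X k, listBoundary R z = 0 → ∃ w ∈ chainsIn R X (k + 1), listBoundary R w = z

theorem chainsIn_mono {X Y : Set P} (h : X ⊆ Y) (k : ℕ) : chainsIn R X k ≤ chainsIn R Y k :=
  Finsupp.supported_mono fun _ hl => ⟨hl.1, hl.2.1, fun p hp => h (hl.2.2 p hp)⟩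

theorem cons_mem_chainLists {X : Set P} {k : ℕ} {a : P} {l : List P} :
    a :: l ∈ chainLists X (k + 1) ↔ a ∈ X ∧ l ∈ chainLists (X ∩ Set.Ioi a) k := by
  simp only [chainLists, Set.mem_ofPred_eq, List.length_cons, List.pairwise_cons, List.mem_cons,
    forall_eq_or_imp, Set.mem_inter_iff, Set.mem_Ioi]
  constructor
  · rintro ⟨h1, ⟨h2, h3⟩, h4, h5⟩
    exact ⟨h4, by omega, h3, fun p hp => ⟨h5 p hp, h2 p hp⟩⟩
  · rintro ⟨h4, h1, h3, h5⟩
    exact ⟨by omega, ⟨fun p hp => (h5 p hp).2, h3⟩, h4, fun p hp => (h5 p hp).1⟩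

theorem consMap_mem_chainsIn {X : Set P} {k : ℕ} {a : P} (ha : a ∈ X) {z : List P →₀ R}
    (hz : z ∈ chainsIn R (X ∩ Set.Ioi a) k) : consMap R a z ∈ chainsIn R X (k + 1) := by
  have h : consMap R a z ∈ Finsupp.supported R R (List.cons a '' chainLists (X ∩ Set.Ioi a) k) := by
    rw [← Finsupp.lmapDomain_supported]
    exact Submodule.mem_map_of_mem hz
  refine Finsupp.supported_mono ?_ h
  rintro _ ⟨l, hl, rfl⟩
  exact cons_mem_chainLists.2 ⟨ha, hl⟩

theorem listBoundary_mem_chainsIn {X : Set P} {k : ℕ} {z : List P →₀ R}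
    (hz : z ∈ chainsIn R X (k + 1)) : listBoundary R z ∈ chainsIn R X k := by
  have key : ∀ (l : List P) (X : Set P) (k : ℕ), l ∈ chainLists X (k + 1) →
      listBoundaryAux R l ∈ chainsIn R X k := by
    intro l
    induction l with
    | nil => intro X k h; simp [chainLists] at h
    | cons a l ih =>
      intro X k h
      obtain ⟨ha, hl⟩ := cons_mem_chainLists.1 h
      refine Submodule.sub_mem _ (Finsupp.single_mem_supported R _
        ⟨hl.1, hl.2.1, fun p hp => (hl.2.2 p hp).1⟩) ?_
      cases k with
      | zero =>
        obtain rfl := List.length_eq_zero_iff.1 hl.1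
        simp [listBoundaryAux]
      | succ k => exact consMap_mem_chainsIn ha (ih _ _ hl)
  rw [chainsIn, Finsupp.supported_eq_span_single] at hz
  induction hz using Submodule.span_induction with
  | mem x hx =>
    obtain ⟨l, hl, rfl⟩ := hx
    rw [listBoundary_single, one_smul]
    exact key l X k hl
  | zero => simp
  | add x y _ _ hx hy => rw [map_add]; exact Submodule.add_mem _ hx hy
  | smul r x _ hx => rw [map_smul]; exact Submodule.smul_mem _ _ hx

/-! ### Nonempty posets, cones and unions -/

theorem acyclicAt_zero {X : Set P} (h : X.Nonempty) : AcyclicAt R X 0 := by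
  obtain ⟨a, ha⟩ := h
  rintro z hz -
  have h0 : listBoundary R z = 0 := by
    rw [chainsIn, Finsupp.supported_eq_span_single] at hz
    induction hz using Submodule.span_induction with
    | mem x hx =>
      obtain ⟨l, hl, rfl⟩ := hx
      obtain rfl := List.length_eq_zero_iff.1 hl.1
      simp [listBoundary_single, listBoundaryAux]
    | zero => simp
    | add x y _ _ hx hy => rw [map_add, hx, hy, add_zero]
    | smul r x _ hx => rw [map_smul, hx, smul_zero]
  refine ⟨consMap R a z, consMap_mem_chainsIn ha (Finsupp.supported_mono ?_ hz), ?_⟩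
  · intro l hl
    obtain rfl := List.length_eq_zero_iff.1 hl.1
    exact ⟨rfl, by simp, by simp⟩
  · rw [listBoundary_consMap, h0, map_zero, sub_zero]

/-- The order complex of a set with a least element `a` is a cone with apex `a`. -/
theorem acyclicAt_of_isLeast {X : Set P} {a : P} (h : IsLeast X a) (k : ℕ) :
    AcyclicAt R X k := by
  cases k with
  | zero => exact acyclicAt_zero ⟨a, h.1⟩
  | succ k =>
    intro z hz hz0
    set Y : Set P := X ∩ Set.Ioi a
    have hsub : chainLists X (k + 1) ⊆ List.cons a '' chainLists Y k ∪ chainLists Y (k + 1) := by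
      intro l hl
      cases l with
      | nil => simp [chainLists] at hl
      | cons b l =>
        obtain ⟨hb, hl'⟩ := cons_mem_chainLists.1 hl
        rcases (h.2 hb).eq_or_lt with rfl | hab
        · exact Or.inl ⟨l, hl', rfl⟩
        · refine Or.inr (cons_mem_chainLists.2 ⟨⟨hb, hab⟩, hl'.1, hl'.2.1, fun p hp => ?_⟩)
          obtain ⟨h1, h2⟩ := hl'.2.2 p hp
          exact ⟨⟨h1, hab.trans h2⟩, h2⟩
    have hz' := Finsupp.supported_mono (R := R) (M := R) hsub hz
    rw [Finsupp.supported_union, ← Finsupp.lmapDomain_supported] at hz'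
    obtain ⟨_, ⟨z₁, hz₁, rfl⟩, z₂, hz₂, rfl⟩ := Submodule.mem_sup.1 hz'
    change listBoundary R (consMap R a z₁ + z₂) = 0 at hz0
    change z₁ ∈ chainsIn R Y k at hz₁
    change z₂ ∈ chainsIn R Y (k + 1) at hz₂
    change ∃ w ∈ chainsIn R X (k + 1 + 1), listBoundary R w = consMap R a z₁ + z₂
    -- the terms of the boundary that contain `a` and those that do not vanish separately
    have hrel : z₁ + listBoundary R z₂ = consMap R a (listBoundary R z₁) := by
      rw [map_add, listBoundary_consMap] at hz0
      rw [← sub_eq_zero, ← hz0]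
      abel
    have hd : Disjoint (chainLists Y k) (Set.range (List.cons a)) := by
      rw [Set.disjoint_left]
      rintro _ hl ⟨l, rfl⟩
      exact lt_irrefl a (hl.2.2 a (by simp)).2
    have hzero : z₁ + listBoundary R z₂ = 0 := by
      refine Submodule.disjoint_def.1 (Finsupp.disjoint_supported_supported
        (R := R) (M := R) hd) _ (Submodule.add_mem _ hz₁ (listBoundary_mem_chainsIn hz₂)) ?_
      rw [hrel, ← Set.image_univ, ← Finsupp.lmapDomain_supported]
      exact Submodule.mem_map_of_mem (by simp)
    refine ⟨consMap R a z₂, consMap_mem_chainsIn h.1 hz₂, ?_⟩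
    rw [listBoundary_consMap, eq_neg_of_add_eq_zero_right hzero, map_neg]
    abel

/-- The part of the Mayer-Vietoris sequence that is needed: if every chain of `A ∪ B` lies in `A`
or in `B`, vanishing for `A`, `B`, and, one dimension lower, `A ∩ B` gives it for `A ∪ B`. -/
theorem AcyclicAt.union {A B : Set P} {k : ℕ}
    (hAB : chainLists (A ∪ B) (k + 1) ⊆ chainLists A (k + 1) ∪ chainLists B (k + 1))
    (hA : AcyclicAt R A (k + 1)) (hB : AcyclicAt R B (k + 1)) (hI : AcyclicAt R (A ∩ B) k) :
    AcyclicAt R (A ∪ B) (k + 1) := by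
  intro z hz hz0
  have hz' := Finsupp.supported_mono (R := R) (M := R) hAB hz
  rw [Finsupp.supported_union] at hz'
  obtain ⟨zA, hzA, zB, hzB, rfl⟩ := Submodule.mem_sup.1 hz'
  change zA ∈ chainsIn R A (k + 1) at hzA
  change zB ∈ chainsIn R B (k + 1) at hzB
  have hneg : listBoundary R zA = -listBoundary R zB := by
    rw [map_add] at hz0
    exact eq_neg_of_add_eq_zero_left hz0
  have hmem : listBoundary R zA ∈ chainsIn R (A ∩ B) k := by
    have h1 : listBoundary R zA ∈ chainsIn R A k := listBoundary_mem_chainsIn hzA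
    have h2 : listBoundary R zA ∈ chainsIn R B k := by
      rw [hneg]
      exact Submodule.neg_mem _ (listBoundary_mem_chainsIn hzB)
    have h3 : listBoundary R zA ∈ chainsIn R A k ⊓ chainsIn R B k := ⟨h1, h2⟩
    rw [chainsIn, chainsIn, ← Finsupp.supported_inter] at h3
    refine Finsupp.supported_mono ?_ h3
    intro l hl
    exact ⟨hl.1.1, hl.1.2.1, fun p hp => ⟨hl.1.2.2 p hp, hl.2.2.2 p hp⟩⟩
  obtain ⟨u, hu, hbu⟩ := hI _ hmem (listBoundary_listBoundary zA)
  obtain ⟨vA, hvA, hA'⟩ := hA (zA - u)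
    (Submodule.sub_mem _ hzA (chainsIn_mono Set.inter_subset_left _ hu))
    (by rw [map_sub, hbu, sub_self])
  obtain ⟨vB, hvB, hB'⟩ := hB (zB + u)
    (Submodule.add_mem _ hzB (chainsIn_mono Set.inter_subset_right _ hu))
    (by rw [map_add, hbu, hneg, add_neg_cancel])
  refine ⟨vA + vB, Submodule.add_mem _ (chainsIn_mono Set.subset_union_left _ hvA)
    (chainsIn_mono Set.subset_union_right _ hvB), ?_⟩
  rw [map_add, hA', hB']
  abel

/-! ### Recursive atom orderings give vanishing homology -/

/-- Adding the atoms `a` of a recursive atom ordering one at a time adds to the order complex the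
cone over `[a, y)`, and the part of this cone that was there before is of the same form in the
upper interval of `a`, by the atoms of `[a, 1̂]` that cover earlier atoms. -/
theorem IsRAO.acyclicAt {ρ : P → ℕ} (hcov : ∀ a b : P, a ⋖ b → ρ b = ρ a + 1)
    {x : P} {L : List P} (h : IsRAO x L) (y : P) (L₁ L₂ : List P) (hL : L = L₁ ++ L₂)
    (hne : ∃ a ∈ L₁, a < y) (k : ℕ) (hk : ρ x + k + 2 ≤ ρ y) :
    AcyclicAt R {z | z < y ∧ ∃ a ∈ L₁, a ≤ z} k := by
  induction h generalizing y L₁ L₂ k with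
  | intro x L nodup mem_iff fst rst rao cf nr cc ih =>
    induction L₁ using List.reverseRecOn generalizing L₂ k with
    | nil => simp at hne
    | append_singleton L₀ a ihL =>
      -- `a` is the atom number `j`
      obtain ⟨j, hj, hja⟩ : ∃ j : Fin L.length, (j : ℕ) = L₀.length ∧ L.get j = a := by
        refine ⟨⟨L₀.length, by simp [hL]⟩, rfl, ?_⟩
        simp [hL]
      have hmem : ∀ b, b ∈ L₀ ↔ ∃ i, i < j ∧ L.get i = b := by
        intro b
        constructor
        · intro hb
          obtain ⟨i, hi, rfl⟩ := List.mem_iff_getElem.1 hb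
          refine ⟨⟨i, by simp [hL]; omega⟩, by rw [Fin.lt_def, hj]; exact hi, ?_⟩
          simp [hL, hi]
        · rintro ⟨i, hij, rfl⟩
          rw [Fin.lt_def, hj] at hij
          simp [hL, hij]
      have cov : ∀ i, x ⋖ L.get i := fun i => (mem_iff _).1 (L.get_mem i)
      have hinj : ∀ i i', i < i' → L.get i ≠ L.get i' := fun i i' hii h =>
        hii.ne (List.nodup_iff_injective_get.1 nodup h)
      have hL' : L = L₀ ++ (a :: L₂) := by simp [hL]
      have hsplit : {z | z < y ∧ ∃ b ∈ L₀ ++ [a], b ≤ z} =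
          {z | z < y ∧ ∃ b ∈ L₀, b ≤ z} ∪ {z | z < y ∧ a ≤ z} := by
        ext z
        simp only [List.mem_append, List.mem_singleton, Set.mem_ofPred_eq, Set.mem_union]
        constructor
        · rintro ⟨hz, b, hb | rfl, hbz⟩
          · exact Or.inl ⟨hz, b, hb, hbz⟩
          · exact Or.inr ⟨hz, hbz⟩
        · rintro (⟨hz, b, hb, hbz⟩ | ⟨hz, hbz⟩)
          · exact ⟨hz, b, Or.inl hb, hbz⟩
          · exact ⟨hz, a, Or.inr rfl, hbz⟩
      rw [hsplit]
      by_cases hay : a < y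
      swap
      · have hemp : {z | z < y ∧ a ≤ z} = ∅ := by
          ext z
          simp only [Set.mem_ofPred_eq, Set.mem_empty_iff_false, iff_false]
          exact fun h => hay (h.2.trans_lt h.1)
        rw [hemp, Set.union_empty]
        refine ihL (a :: L₂) hL' ?_ k hk
        obtain ⟨b, hb, hby⟩ := hne
        rcases List.mem_append.1 hb with hb | hb
        · exact ⟨b, hb, hby⟩
        · rw [List.mem_singleton.1 hb] at hby
          exact absurd hby hay
      have hcone : IsLeast {z | z < y ∧ a ≤ z} a := ⟨⟨hay, le_rfl⟩, fun z hz => hz.2⟩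
      by_cases hne₀ : ∃ b ∈ L₀, b < y
      swap
      · have hemp : {z | z < y ∧ ∃ b ∈ L₀, b ≤ z} = ∅ := by
          ext z
          simp only [Set.mem_ofPred_eq, Set.mem_empty_iff_false, iff_false]
          exact fun ⟨h1, b, h2, h3⟩ => hne₀ ⟨b, h2, h3.trans_lt h1⟩
        rw [hemp, Set.empty_union]
        exact acyclicAt_of_isLeast hcone k
      cases k with
      | zero => exact acyclicAt_zero ⟨a, Or.inr hcone.1⟩
      | succ k =>
        refine AcyclicAt.union ?_ (ihL (a :: L₂) hL' hne₀ (k + 1) hk)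
          (acyclicAt_of_isLeast hcone _) ?_
        · intro l hl
          cases l with
          | nil => simp [chainLists] at hl
          | cons c l =>
            have hl' := cons_mem_chainLists.1 hl
            rcases hl'.1 with hc | hc
            · obtain ⟨hcy, b, hb, hbc⟩ := hc
              refine Or.inl (cons_mem_chainLists.2 ⟨⟨hcy, b, hb, hbc⟩, hl'.2.1, hl'.2.2.1,
                fun p hp => ?_⟩)
              obtain ⟨h1, h2⟩ := hl'.2.2.2 p hp
              refine ⟨⟨?_, b, hb, hbc.trans h2.le⟩, h2⟩
              rcases h1 with h1 | h1 <;> exact h1.1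
            · refine Or.inr (cons_mem_chainLists.2 ⟨hc, hl'.2.1, hl'.2.2.1, fun p hp => ?_⟩)
              obtain ⟨h1, h2⟩ := hl'.2.2.2 p hp
              refine ⟨⟨?_, hc.2.trans h2.le⟩, h2⟩
              rcases h1 with h1 | h1 <;> exact h1.1
        · have hcommon : ∀ i, i < j → ∀ z, L.get i ≤ z → L.get j ≤ z →
              ∃ b ∈ fst j, b ≤ z := by
            intro i hij z hiz hjz
            have hiz' : L.get i < z := hiz.lt_of_ne fun h =>
              CovBy.not_le_of_ne (cov j) (cov i) (hinj i j hij).symm (h ▸ hjz)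
            have hjz' : L.get j < z := hjz.lt_of_ne fun h =>
              CovBy.not_le_of_ne (cov i) (cov j) (hinj i j hij) (h ▸ hiz)
            obtain ⟨i', hi', b, hib, hjb, hbz⟩ := cc i j hij z hiz' hjz'
            rcases List.mem_append.1 (((rao j).mem_iff b).2 hjb) with hb | hb
            · exact ⟨b, hb, hbz⟩
            · exact absurd ⟨i', hi', hib⟩ (nr j b hb)
          have hcovb : ∀ b ∈ fst j, L.get j ⋖ b := fun b hb =>
            ((rao j).mem_iff b).1 (List.mem_append_left _ hb)
          have hinter : {z | z < y ∧ ∃ b ∈ L₀, b ≤ z} ∩ {z | z < y ∧ a ≤ z} =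
              {z | z < y ∧ ∃ b ∈ fst j, b ≤ z} := by
            ext z
            constructor
            · rintro ⟨⟨hzy, b, hb, hbz⟩, -, haz⟩
              obtain ⟨i, hij, rfl⟩ := (hmem b).1 hb
              exact ⟨hzy, hcommon i hij z hbz (hja ▸ haz)⟩
            · rintro ⟨hzy, b, hb, hbz⟩
              obtain ⟨i, hij, hib⟩ := cf j b hb
              exact ⟨⟨hzy, L.get i, (hmem _).2 ⟨i, hij, rfl⟩, hib.le.trans hbz⟩, hzy,
                hja ▸ (hcovb b hb).le.trans hbz⟩
          have hj1 := hcov _ _ (cov j)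
          rw [hinter]
          refine ih j y (fst j) (rst j) rfl ?_ k (by omega)
          obtain ⟨b, hb, hby⟩ := hne₀
          obtain ⟨i, hij, rfl⟩ := (hmem b).1 hb
          obtain ⟨b', hb', hby'⟩ := hcommon i hij y hby.le (hja ▸ hay.le)
          refine ⟨b', hb', hby'.lt_of_ne ?_⟩
          rintro rfl
          have := hcov _ _ (hcovb b' hb')
          omega

/-! ### Comparison with the order complex of an open interval -/

theorem listBoundaryAux_ofFn {Q : Type*} {k : ℕ} (c : Fin (k + 1) → Q) :
    listBoundaryAux R (List.ofFn c) =
      ∑ i : Fin (k + 1), Finsupp.single (List.ofFn (c ∘ i.succAbove)) ((-1 : R) ^ (i : ℕ)) := by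
  induction k with
  | zero => simp [listBoundaryAux]
  | succ k ih =>
    rw [List.ofFn_succ, listBoundaryAux, ih, map_sum, Fin.sum_univ_succ (n := k + 1), sub_eq_add_neg,
      ← Finset.sum_neg_distrib]
    congr 1
    · simp [Function.comp_def]
    · refine Finset.sum_congr rfl fun i _ => ?_
      have : List.ofFn (c ∘ i.succ.succAbove) =
          c 0 :: List.ofFn ((fun j => c j.succ) ∘ i.succAbove) := by
        rw [List.ofFn_succ]
        simp [Function.comp_def]
      rw [this, consMap, Finsupp.lmapDomain_apply, Finsupp.mapDomain_single,
        ← Finsupp.single_neg]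
      simp [pow_succ]

/-- The list of vertices of a chain in an open interval. -/
def OpenChain.toList {x y : P} {k : ℕ} (c : OpenChain x y k) : List P := List.ofFn c.1

theorem OpenChain.toList_injective {x y : P} {k : ℕ} :
    Function.Injective (OpenChain.toList : OpenChain x y k → List P) :=
  fun _ _ h => Subtype.ext (List.ofFn_injective h)

theorem range_toList (x y : P) (k : ℕ) :
    Set.range (OpenChain.toList : OpenChain x y k → List P) = chainLists (Set.Ioo x y) k := by
  ext l
  constructor
  · rintro ⟨c, rfl⟩
    refine ⟨by simp [OpenChain.toList], ?_, ?_⟩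
    · exact List.pairwise_ofFn.2 fun i j hij => c.2.1 hij
    · intro p hp
      obtain ⟨i, rfl⟩ := (List.mem_ofFn' _ _).1 hp
      exact c.2.2 i
  · rintro ⟨rfl, h2, h3⟩
    refine ⟨⟨l.get, fun i j hij => ?_, fun i => h3 _ (l.get_mem i)⟩, by simp [OpenChain.toList]⟩
    exact List.pairwise_iff_get.1 h2 i j hij

theorem listBoundary_mapDomain {x y : P} {k : ℕ} (z : OpenChain x y (k + 1) →₀ R) :
    listBoundary R (Finsupp.mapDomain OpenChain.toList z) =
      Finsupp.mapDomain OpenChain.toList (boundary R x y k z) := by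
  induction z using Finsupp.induction_linear with
  | zero => simp
  | add f g hf hg => simp only [map_add, Finsupp.mapDomain_add, hf, hg]
  | single c r =>
    rw [Finsupp.mapDomain_single, listBoundary_single, boundary,
      Finsupp.linearCombination_single, Finsupp.mapDomain_smul, Finsupp.mapDomain_finsetSum,
      OpenChain.toList, listBoundaryAux_ofFn]
    simp only [Finsupp.mapDomain_single]
    rfl

theorem AcyclicAt.homologyVanishes {x y : P} {k : ℕ} (h : AcyclicAt R (Set.Ioo x y) k) :
    HomologyVanishes R x y k := by
  have hrange : ∀ m, LinearMap.range (Finsupp.lmapDomain R R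
      (OpenChain.toList : OpenChain x y m → List P)) = chainsIn R (Set.Ioo x y) m := by
    intro m
    rw [LinearMap.range_eq_map, ← Finsupp.supported_univ, Finsupp.lmapDomain_supported,
      Set.image_univ, range_toList, chainsIn]
  intro z hz
  have hz0 : listBoundary R (Finsupp.mapDomain OpenChain.toList z) = 0 := by
    cases k with
    | zero =>
      induction z using Finsupp.induction_linear with
      | zero => simp
      | add f g hf hg =>
        rw [Finsupp.mapDomain_add, map_add, hf trivial, hg trivial, add_zero]
      | single c r =>
        rw [Finsupp.mapDomain_single, listBoundary_single]
        simp [OpenChain.toList, listBoundaryAux]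
    | succ k =>
      have hz' : boundary R x y k z = 0 := hz
      rw [listBoundary_mapDomain, hz', Finsupp.mapDomain_zero]
  obtain ⟨w, hw, hwz⟩ := h _ (hrange k ▸ LinearMap.mem_range_self _ z) hz0
  rw [← hrange] at hw
  obtain ⟨w, rfl⟩ := hw
  refine ⟨w, Finsupp.mapDomain_injective OpenChain.toList_injective ?_⟩
  rw [← listBoundary_mapDomain]
  exact hwz

variable (R) in
/-- A graded poset with a recursive atom ordering is Cohen-Macaulay. -/
theorem IsRAO.cohenMacaulay [OrderBot P] [IsStronglyAtomic P] {ρ : P → ℕ} (hρ : StrictMono ρ)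
    (hcov : ∀ a b : P, a ⋖ b → ρ b = ρ a + 1) {L : List P} (h : IsRAO (⊥ : P) L)
    (hg : IsGradedPoset P) : CohenMacaulay R P := by
  refine ⟨hg, fun x y hxy k ⟨c⟩ => AcyclicAt.homologyVanishes ?_⟩
  obtain ⟨L', hL'⟩ := h.exists_of_le (bot_le : ⊥ ≤ x)
  have hset : Set.Ioo x y = {z | z < y ∧ ∃ a ∈ L', a ≤ z} := by
    ext z
    constructor
    · rintro ⟨h1, h2⟩
      obtain ⟨a, ha, haz⟩ := exists_covBy_le_of_lt h1
      exact ⟨h2, a, (hL'.mem_iff a).2 ha, haz⟩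
    · rintro ⟨h1, a, ha, haz⟩
      exact ⟨((hL'.mem_iff a).1 ha).lt.trans_le haz, h1⟩
  rw [hset]
  refine hL'.acyclicAt hcov y L' [] (by simp) ?_ k ?_
  · have hc := c.2.2 0
    obtain ⟨a, ha, haz⟩ := exists_covBy_le_of_lt hc.1
    exact ⟨a, (hL'.mem_iff a).2 ha, haz.trans_lt hc.2⟩
  · have hlen : ∀ i : ℕ, ∀ hi : i < k + 1, ρ x + i + 1 ≤ ρ (c.1 ⟨i, hi⟩) := by
      intro i
      induction i with
      | zero => intro hi; exact hρ (c.2.2 _).1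
      | succ i ih =>
        intro hi
        have h1 := ih (by omega)
        have h2 : ρ (c.1 ⟨i, by omega⟩) < ρ (c.1 ⟨i + 1, hi⟩) :=
          hρ (c.2.1 (by simp [Fin.lt_def]))
        omega
    have h1 := hlen k (by omega)
    have h2 := hρ (c.2.2 ⟨k, by omega⟩).2
    omega

end Homology

/-! ### Unions of initial segments of lists of blocks -/

section Lists

variable {α : Type*} [DecidableEq α]

/-- The union of the blocks in a list. -/
def unionOf (l : List (Finset α)) : Finset α := l.toFinset.biUnion id

theorem mem_unionOf {l : List (Finset α)} {x : α} : x ∈ unionOf l ↔ ∃ B ∈ l, x ∈ B := by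
  simp [unionOf]

theorem unionOf_append (l m : List (Finset α)) :
    unionOf (l ++ m) = unionOf l ∪ unionOf m := by
  ext x
  simp only [mem_unionOf, List.mem_append, Finset.mem_union, or_and_right, exists_or]

theorem unionOf_cons (B : Finset α) (l : List (Finset α)) :
    unionOf (B :: l) = B ∪ unionOf l := by
  ext x
  simp [mem_unionOf]

theorem unionOf_nil : unionOf ([] : List (Finset α)) = ∅ := rfl

theorem disjoint_unionOf {B : Finset α} {l : List (Finset α)} (h : ∀ C ∈ l, Disjoint B C) :
    Disjoint B (unionOf l) := by
  rw [Finset.disjoint_left]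
  intro x hx hx'
  obtain ⟨C, hC, hxC⟩ := mem_unionOf.1 hx'
  exact Finset.disjoint_left.1 (h C hC) hx hxC

theorem card_unionOf {l : List (Finset α)} (h : l.Pairwise Disjoint) :
    (unionOf l).card = (l.map Finset.card).sum := by
  induction l with
  | nil => rfl
  | cons B l ih =>
    obtain ⟨h1, h2⟩ := List.pairwise_cons.1 h
    rw [unionOf_cons, Finset.card_union_of_disjoint (disjoint_unionOf h1), ih h2]
    simp

/-- Initial segments of a list of disjoint nonempty blocks are ordered as their unions. -/
theorem prefix_of_unionOf_subset {l p q : List (Finset α)} (hd : l.Pairwise Disjoint)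
    (hne : ∀ B ∈ l, B.Nonempty) (hp : p <+: l) (hq : q <+: l) (h : unionOf p ⊆ unionOf q) :
    p <+: q := by
  rcases List.prefix_or_prefix_of_prefix hp hq with h' | ⟨t, rfl⟩
  · exact h'
  cases t with
  | nil => simp
  | cons B t =>
    obtain ⟨x, hx⟩ := hne B (hp.subset (by simp))
    have hxq : x ∈ unionOf q := h (mem_unionOf.2 ⟨B, by simp, hx⟩)
    obtain ⟨C, hC, hxC⟩ := mem_unionOf.1 hxq
    have := (List.pairwise_append.1 (hd.sublist hp.sublist)).2.2 C hC B (by simp)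
    exact absurd hx (Finset.disjoint_left.1 this hxC)

/-- A list of disjoint nonempty blocks is determined by the unions of its initial segments. -/
theorem eq_of_unionOf_prefixes {l m : List (Finset α)} (hl : l.Pairwise Disjoint)
    (hm : m.Pairwise Disjoint) (hl' : ∀ B ∈ l, B.Nonempty) (hm' : ∀ B ∈ m, B.Nonempty)
    (hlm : ∀ p, p <+: l → ∃ q, q <+: m ∧ unionOf q = unionOf p)
    (hml : ∀ p, p <+: m → ∃ q, q <+: l ∧ unionOf q = unionOf p) : l = m := by
  have nonempty_case : ∀ (B : Finset α) (l : List (Finset α)), (∀ C ∈ B :: l, C.Nonempty) →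
      ¬ ∃ q, q <+: ([] : List (Finset α)) ∧ unionOf q = unionOf (B :: l) := by
    rintro B l h ⟨q, hq, hqB⟩
    obtain ⟨x, hx⟩ := h B (by simp)
    rw [List.prefix_nil.1 hq, unionOf_cons, unionOf_nil] at hqB
    have : x ∈ (∅ : Finset α) := hqB ▸ Finset.mem_union_left _ hx
    simp at this
  -- the first block is the smallest nonempty union of an initial segment
  have first_subset : ∀ (B C : Finset α) (l m : List (Finset α)), B.Nonempty →
      (∃ q, q <+: C :: m ∧ unionOf q = unionOf [B]) → C ⊆ B := by
    rintro B C l m ⟨x, hx⟩ ⟨q, hq, hqB⟩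
    rw [unionOf_cons, unionOf_nil, Finset.union_empty] at hqB
    cases q with
    | nil => rw [← hqB] at hx; simp [unionOf_nil] at hx
    | cons D q =>
      obtain ⟨rfl, -⟩ := List.cons_prefix_cons.1 hq
      rw [← hqB, unionOf_cons]
      exact Finset.subset_union_left
  have tails : ∀ (B : Finset α) (l m : List (Finset α)), B.Nonempty → (B :: l).Pairwise Disjoint →
      (B :: m).Pairwise Disjoint →
      (∀ p, p <+: B :: l → ∃ q, q <+: B :: m ∧ unionOf q = unionOf p) →
      ∀ p, p <+: l → ∃ q, q <+: m ∧ unionOf q = unionOf p := by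
    rintro B l m ⟨x, hx⟩ hl hm h p hp
    obtain ⟨q, hq, hqp⟩ := h (B :: p) (List.cons_prefix_cons.2 ⟨rfl, hp⟩)
    rw [unionOf_cons] at hqp
    cases q with
    | nil =>
      have : x ∈ (∅ : Finset α) := (unionOf_nil.symm.trans hqp) ▸ Finset.mem_union_left _ hx
      simp at this
    | cons D q =>
      obtain ⟨rfl, hq'⟩ := List.cons_prefix_cons.1 hq
      refine ⟨q, hq', ?_⟩
      rw [unionOf_cons] at hqp
      have h1 : Disjoint D (unionOf q) := disjoint_unionOf fun C hC =>
        (List.pairwise_cons.1 hm).1 C (hq'.subset hC)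
      have h2 : Disjoint D (unionOf p) := disjoint_unionOf fun C hC =>
        (List.pairwise_cons.1 hl).1 C (hp.subset hC)
      rw [← Finset.union_sdiff_cancel_left h1, hqp, Finset.union_sdiff_cancel_left h2]
  induction l generalizing m with
  | nil =>
    cases m with
    | nil => rfl
    | cons C m => exact absurd (hml _ (List.prefix_refl _)) (nonempty_case C m hm')
  | cons B l ih =>
    cases m with
    | nil => exact absurd (hlm _ (List.prefix_refl _)) (nonempty_case B l hl')
    | cons C m =>
      have hB := hl' B (by simp)
      have hC := hm' C (by simp)
      have hBC : B = C := Finset.Subset.antisymm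
        (first_subset C B m l hC (hml [C] (by simp)))
        (first_subset B C l m hB (hlm [B] (by simp)))
      subst hBC
      rw [ih (List.pairwise_cons.1 hl).2 (List.pairwise_cons.1 hm).2
        (fun D hD => hl' D (by simp [hD])) (fun D hD => hm' D (by simp [hD]))
        (tails B l m hB hl hm hlm) (tails B m l hB hm hl hml)]

end Lists

namespace DivPartition

variable {n d : ℕ}

/-! ### Ordered set partitions as chains of subsets -/

theorem unionOf_blocks (ω : DivPartition n d) : unionOf ω.blocks = Finset.univ := by
  ext i
  simpa [mem_unionOf] using ω.cover i

/-- The unions of the nonempty proper initial segments of the sequence of blocks. They form a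
chain of proper nonempty subsets, which determines the ordered set partition. -/
def initialUnions (ω : DivPartition n d) : Finset (Finset (Fin n)) :=
  (Finset.Ico 1 ω.blocks.length).image fun i => unionOf (ω.blocks.take i)

theorem mem_initialUnions {ω : DivPartition n d} {S : Finset (Fin n)} :
    S ∈ ω.initialUnions ↔
      ∃ l₁ l₂, ω.blocks = l₁ ++ l₂ ∧ l₁ ≠ [] ∧ l₂ ≠ [] ∧ unionOf l₁ = S := by
  simp only [initialUnions, Finset.mem_image, Finset.mem_Ico]
  constructor
  · rintro ⟨i, ⟨h1, h2⟩, rfl⟩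
    refine ⟨ω.blocks.take i, ω.blocks.drop i, (List.take_append_drop i _).symm, ?_, ?_, rfl⟩
    · rw [Ne, ← List.length_eq_zero_iff, List.length_take]
      omega
    · rw [Ne, ← List.length_eq_zero_iff, List.length_drop]
      omega
  · rintro ⟨l₁, l₂, h, h1, h2, rfl⟩
    have h1' := List.length_pos_iff.2 h1
    have h2' := List.length_pos_iff.2 h2
    exact ⟨l₁.length, ⟨h1', by simp [h]; omega⟩, by simp [h]⟩

theorem card_initialUnions (ω : DivPartition n d) :
    ω.initialUnions.card + 1 = ω.blocks.length := by
  have h0 := List.length_pos_iff.2 ω.ne_nil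
  rw [initialUnions, Finset.card_image_of_injOn]
  · simp only [Nat.card_Ico]
    omega
  · intro i hi j hj hij
    simp only [Finset.coe_Ico, Set.mem_Ico] at hi hj
    have h1 := (prefix_of_unionOf_subset ω.disjoint ω.block_nonempty (List.take_prefix i _)
      (List.take_prefix j _) hij.subset).length_le
    have h2 := (prefix_of_unionOf_subset ω.disjoint ω.block_nonempty (List.take_prefix j _)
      (List.take_prefix i _) hij.superset).length_le
    simp only [List.length_take] at h1 h2
    omega

theorem initialUnions_injective :
    Function.Injective (initialUnions : DivPartition n d → Finset (Finset (Fin n))) := by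
  have key : ∀ ω ψ : DivPartition n d, ω.initialUnions = ψ.initialUnions →
      ∀ p, p <+: ω.blocks → ∃ q, q <+: ψ.blocks ∧ unionOf q = unionOf p := by
    rintro ω ψ h p ⟨s, hs⟩
    by_cases hp : p = []
    · exact ⟨[], List.nil_prefix, by rw [hp]⟩
    by_cases hs' : s = []
    · refine ⟨ψ.blocks, List.prefix_refl _, ?_⟩
      rw [hs', List.append_nil] at hs
      rw [hs, unionOf_blocks, unionOf_blocks]
    · have hm : unionOf p ∈ ψ.initialUnions := by
        rw [← h]
        exact mem_initialUnions.2 ⟨p, s, hs.symm, hp, hs', rfl⟩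
      obtain ⟨q, t, hqt, -, -, hq⟩ := mem_initialUnions.1 hm
      exact ⟨q, ⟨t, hqt.symm⟩, hq⟩
  intro ω ψ h
  exact DivPartition.ext (eq_of_unionOf_prefixes ω.disjoint ψ.disjoint ω.block_nonempty
    ψ.block_nonempty (key ω ψ h) (key ψ ω h.symm))

/-- Merging two adjacent blocks removes from the chain of initial unions the one that ends
between them. -/
theorem initialUnions_merge {ω ψ : DivPartition n d} {l₁ l₂ : List (Finset (Fin n))}
    {B C : Finset (Fin n)} (hω : ω.blocks = l₁ ++ B :: C :: l₂)
    (hψ : ψ.blocks = l₁ ++ (B ∪ C) :: l₂) :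
    unionOf (l₁ ++ [B]) ∈ ω.initialUnions ∧
      ψ.initialUnions = ω.initialUnions.erase (unionOf (l₁ ++ [B])) := by
  have hv : unionOf (l₁ ++ [B]) ∈ ω.initialUnions :=
    mem_initialUnions.2 ⟨l₁ ++ [B], C :: l₂, by simp [hω], by simp, by simp, rfl⟩
  have h1 : ψ.initialUnions ⊆ ω.initialUnions := by
    intro S hS
    obtain ⟨p, s, hps, hp, hs, rfl⟩ := mem_initialUnions.1 hS
    rw [hψ] at hps
    rcases List.append_eq_append_iff.1 hps with ⟨t, rfl, ht⟩ | ⟨t, rfl, rfl⟩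
    · cases t with
      | nil =>
        refine mem_initialUnions.2 ⟨l₁, B :: C :: l₂, hω, by simpa using hp, by simp, by simp⟩
      | cons D t =>
        simp only [List.cons_append, List.cons.injEq] at ht
        obtain ⟨rfl, rfl⟩ := ht
        refine mem_initialUnions.2 ⟨l₁ ++ B :: C :: t, s, by simp [hω], by simp, hs, ?_⟩
        simp [unionOf_append, unionOf_cons, Finset.union_assoc]
    · exact mem_initialUnions.2 ⟨p, t ++ B :: C :: l₂, by simp [hω], hp, by simp, rfl⟩
  have h2 : ω.initialUnions ⊆ insert (unionOf (l₁ ++ [B])) ψ.initialUnions := by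
    intro S hS
    obtain ⟨p, s, hps, hp, hs, rfl⟩ := mem_initialUnions.1 hS
    rw [hω] at hps
    rw [Finset.mem_insert]
    rcases List.append_eq_append_iff.1 hps with ⟨t, rfl, ht⟩ | ⟨t, rfl, rfl⟩
    · rcases t with _ | ⟨D, _ | ⟨E, t⟩⟩
      · exact Or.inr (mem_initialUnions.2
          ⟨l₁, (B ∪ C) :: l₂, hψ, by simpa using hp, by simp, by simp⟩)
      · simp only [List.cons_append, List.nil_append, List.cons.injEq] at ht
        rw [ht.1]
        exact Or.inl rfl
      · simp only [List.cons_append, List.cons.injEq] at ht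
        obtain ⟨rfl, rfl, rfl⟩ := ht
        refine Or.inr (mem_initialUnions.2
          ⟨l₁ ++ (B ∪ C) :: t, s, by simp [hψ], by simp, hs, ?_⟩)
        simp [unionOf_append, unionOf_cons, Finset.union_assoc]
    · exact Or.inr (mem_initialUnions.2 ⟨p, t ++ (B ∪ C) :: l₂, by simp [hψ], hp, by simp, rfl⟩)
  refine ⟨hv, ?_⟩
  have hc : ψ.initialUnions.card + 1 = ω.initialUnions.card := by
    have e1 := card_initialUnions ω
    have e2 := card_initialUnions ψ
    rw [hω] at e1
    rw [hψ] at e2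
    simp only [List.length_append, List.length_cons] at e1 e2
    omega
  have hnv : unionOf (l₁ ++ [B]) ∉ ψ.initialUnions := fun h => by
    rw [Finset.insert_eq_of_mem h] at h2
    have := Finset.card_le_card h2
    omega
  refine Finset.Subset.antisymm (Finset.subset_erase.2 ⟨h1, hnv⟩) fun S hS => ?_
  exact (Finset.mem_insert.1 (h2 (Finset.mem_of_mem_erase hS))).resolve_left
    (Finset.ne_of_mem_erase hS)

theorem exists_merge (ω : DivPartition n d) {l₁ l₂ : List (Finset (Fin n))}
    {B C : Finset (Fin n)} (hω : ω.blocks = l₁ ++ B :: C :: l₂) :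
    ∃ ψ : DivPartition n d, ψ.blocks = l₁ ++ (B ∪ C) :: l₂ := by
  have hdis := ω.disjoint
  have hne := ω.block_nonempty
  have hcov := ω.cover
  have hdvd := ω.dvd_card
  rw [hω] at hdis hne hcov hdvd
  simp only [List.pairwise_append, List.pairwise_cons, List.mem_cons, forall_eq_or_imp] at hdis
  obtain ⟨h1, ⟨⟨hBC, hB⟩, hC, h2⟩, h3⟩ := hdis
  refine ⟨⟨l₁ ++ (B ∪ C) :: l₂, by simp, ?_, ?_, ?_, ?_⟩, rfl⟩
  · intro D hD
    rcases List.mem_append.1 hD with hD | hD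
    · exact hne D (by simp [hD])
    · rcases List.mem_cons.1 hD with rfl | hD
      · exact (hne B (by simp)).mono Finset.subset_union_left
      · exact hne D (by simp [hD])
  · simp only [List.pairwise_append, List.pairwise_cons, List.mem_cons, forall_eq_or_imp,
      Finset.disjoint_union_left, Finset.disjoint_union_right]
    exact ⟨h1, ⟨fun D hD => ⟨hB D hD, hC D hD⟩, h2⟩,
      fun D hD => ⟨⟨(h3 D hD).1, (h3 D hD).2.1⟩, (h3 D hD).2.2⟩⟩
  · intro i
    obtain ⟨D, hD, hi⟩ := hcov i
    simp only [List.mem_append, List.mem_cons] at hD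
    rcases hD with hD | rfl | rfl | hD
    · exact ⟨D, by simp [hD], hi⟩
    · exact ⟨D ∪ C, by simp, Finset.mem_union_left _ hi⟩
    · exact ⟨B ∪ D, by simp, Finset.mem_union_right _ hi⟩
    · exact ⟨D, by simp [hD], hi⟩
  · intro D hD
    rcases List.mem_append.1 hD with hD | hD
    · exact hdvd D (by simp [hD])
    · rcases List.mem_cons.1 hD with rfl | hD
      · rw [Finset.card_union_of_disjoint hBC]
        exact dvd_add (hdvd B (by simp)) (hdvd C (by simp))
      · exact hdvd D (by simp [hD])

theorem exists_split (ω : DivPartition n d) {l₁ l₂ : List (Finset (Fin n))}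
    {B C : Finset (Fin n)} (hω : ω.blocks = l₁ ++ (B ∪ C) :: l₂) (hBC : Disjoint B C)
    (hBne : B.Nonempty) (hCne : C.Nonempty) (hBd : d ∣ B.card) (hCd : d ∣ C.card) :
    ∃ ψ : DivPartition n d, ψ.blocks = l₁ ++ B :: C :: l₂ := by
  have hdis := ω.disjoint
  have hne := ω.block_nonempty
  have hcov := ω.cover
  have hdvd := ω.dvd_card
  rw [hω] at hdis hne hcov hdvd
  simp only [List.pairwise_append, List.pairwise_cons, List.mem_cons, forall_eq_or_imp,
    Finset.disjoint_union_left, Finset.disjoint_union_right] at hdis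
  obtain ⟨h1, ⟨h4, h2⟩, h3⟩ := hdis
  refine ⟨⟨l₁ ++ B :: C :: l₂, by simp, ?_, ?_, ?_, ?_⟩, rfl⟩
  · intro D hD
    simp only [List.mem_append, List.mem_cons] at hD
    rcases hD with hD | rfl | rfl | hD
    · exact hne D (by simp [hD])
    · exact hBne
    · exact hCne
    · exact hne D (by simp [hD])
  · simp only [List.pairwise_append, List.pairwise_cons, List.mem_cons, forall_eq_or_imp]
    exact ⟨h1, ⟨⟨hBC, fun D hD => (h4 D hD).1⟩, fun D hD => (h4 D hD).2, h2⟩,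
      fun D hD => ⟨(h3 D hD).1.1, (h3 D hD).1.2, (h3 D hD).2⟩⟩
  · intro i
    obtain ⟨D, hD, hi⟩ := hcov i
    simp only [List.mem_append, List.mem_cons] at hD
    rcases hD with hD | rfl | hD
    · exact ⟨D, by simp [hD], hi⟩
    · rcases Finset.mem_union.1 hi with hi | hi
      · exact ⟨B, by simp, hi⟩
      · exact ⟨C, by simp, hi⟩
    · exact ⟨D, by simp [hD], hi⟩
  · intro D hD
    simp only [List.mem_append, List.mem_cons] at hD
    rcases hD with hD | rfl | rfl | hD
    · exact hdvd D (by simp [hD])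
    · exact hBd
    · exact hCd
    · exact hdvd D (by simp [hD])

theorem Merge.le {ω ψ : DivPartition n d} (h : Merge ω ψ) : ω ≤ ψ :=
  Relation.ReflTransGen.single h

theorem initialUnions_subset_of_le {ω ψ : DivPartition n d} (h : ω ≤ ψ) :
    ψ.initialUnions ⊆ ω.initialUnions := by
  change Relation.ReflTransGen Merge ω ψ at h
  induction h with
  | refl => exact Finset.Subset.refl _
  | tail _ hs ih =>
    obtain ⟨l₁, B, C, l₂, h1, h2⟩ := hs
    rw [(initialUnions_merge h1 h2).2]
    exact (Finset.erase_subset _ _).trans ih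

/-- Upper intervals are Boolean: every subset of the chain of `ω` is the chain of a coarsening. -/
theorem exists_initialUnions_eq (ω : DivPartition n d) {T : Finset (Finset (Fin n))}
    (hT : T ⊆ ω.initialUnions) : ∃ ψ, ω ≤ ψ ∧ ψ.initialUnions = T := by
  induction h : (ω.initialUnions \ T).card generalizing ω with
  | zero =>
    rw [Finset.card_eq_zero, Finset.sdiff_eq_empty_iff_subset] at h
    exact ⟨ω, le_rfl, Finset.Subset.antisymm h hT⟩
  | succ m ih =>
    obtain ⟨v, hv⟩ := Finset.card_pos.1 (by omega : 0 < (ω.initialUnions \ T).card)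
    obtain ⟨hvω, hvT⟩ := Finset.mem_sdiff.1 hv
    obtain ⟨p, s, hps, hp, hs, rfl⟩ := mem_initialUnions.1 hvω
    obtain ⟨l₁, B, rfl⟩ := List.eq_nil_or_concat p |>.resolve_left hp
    obtain ⟨C, l₂, rfl⟩ := List.exists_cons_of_ne_nil hs
    have hω : ω.blocks = l₁ ++ B :: C :: l₂ := by simp [hps]
    obtain ⟨ψ, hψ⟩ := ω.exists_merge hω
    obtain ⟨-, he⟩ := initialUnions_merge hω hψ
    obtain ⟨χ, h1, h2⟩ := ih ψ (by rw [he]; exact Finset.subset_erase.2 ⟨hT, by simpa using hvT⟩) (by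
      rw [he, Finset.erase_sdiff_comm, Finset.card_erase_of_mem (by simpa using hv), h]
      rfl)
    exact ⟨χ, (Merge.le ⟨l₁, B, C, l₂, hω, hψ⟩).trans h1, h2⟩

theorem le_iff {ω ψ : DivPartition n d} :
    ω ≤ ψ ↔ ψ.initialUnions ⊆ ω.initialUnions := by
  refine ⟨initialUnions_subset_of_le, fun h => ?_⟩
  obtain ⟨χ, h1, h2⟩ := ω.exists_initialUnions_eq h
  exact initialUnions_injective h2 ▸ h1

theorem lt_iff {ω ψ : DivPartition n d} :
    ω < ψ ↔ ψ.initialUnions ⊂ ω.initialUnions := by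
  rw [lt_iff_le_not_ge, le_iff, le_iff]
  rfl

theorem covBy_of_erase {ω ψ : DivPartition n d} {v : Finset (Fin n)} (hv : v ∈ ω.initialUnions)
    (h : ψ.initialUnions = ω.initialUnions.erase v) : ω ⋖ ψ := by
  have hc := Finset.card_erase_of_mem hv
  have hpos := Finset.card_pos.2 ⟨v, hv⟩
  refine ⟨lt_iff.2 (h ▸ Finset.erase_ssubset hv), fun χ h1 h2 => ?_⟩
  have e1 := Finset.card_lt_card (lt_iff.1 h1)
  have e2 := Finset.card_lt_card (lt_iff.1 h2)
  rw [h] at e2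
  omega

theorem exists_erase_of_covBy {ω ψ : DivPartition n d} (h : ω ⋖ ψ) :
    ∃ v ∈ ω.initialUnions, ψ.initialUnions = ω.initialUnions.erase v := by
  obtain ⟨h1, h2⟩ := Finset.ssubset_iff_subset_ne.1 (lt_iff.1 h.lt)
  obtain ⟨v, hv, hv'⟩ := Finset.exists_of_ssubset (lt_iff.1 h.lt)
  refine ⟨v, hv, ?_⟩
  obtain ⟨χ, h3, h4⟩ := ω.exists_initialUnions_eq (Finset.erase_subset v _)
  have h5 : χ ≤ ψ := le_iff.2 (h4 ▸ Finset.subset_erase.2 ⟨h1, hv'⟩)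
  have h6 : ω < χ := (covBy_of_erase hv h4).lt
  rw [← h5.eq_of_not_lt (h.2 h6), h4]

instance : Finite (DivPartition n d) := Finite.of_injective _ initialUnions_injective

/-! ### Atoms and the rank function -/

theorem sum_card_blocks (ω : DivPartition n d) : (ω.blocks.map Finset.card).sum = n := by
  rw [← card_unionOf ω.disjoint, unionOf_blocks, Finset.card_univ, Fintype.card_fin]

theorem le_card_of_mem (ω : DivPartition n d) {B : Finset (Fin n)} (hB : B ∈ ω.blocks) :
    d ≤ B.card :=
  Nat.le_of_dvd (Finset.card_pos.2 (ω.block_nonempty B hB)) (ω.dvd_card B hB)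

theorem length_mul_le (ω : DivPartition n d) : ω.blocks.length * d ≤ n := by
  have h := List.card_nsmul_le_sum (ω.blocks.map Finset.card) d (by
    intro m hm
    obtain ⟨B, hB, rfl⟩ := List.mem_map.1 hm
    exact ω.le_card_of_mem hB)
  rw [sum_card_blocks] at h
  simpa using h

theorem length_mul_eq {ω : DivPartition n d} (h : ∀ B ∈ ω.blocks, B.card = d) :
    ω.blocks.length * d = n := by
  rw [← smul_eq_mul, ← List.sum_replicate, ← List.map_const', ← List.map_congr_left h,
    sum_card_blocks]

/-- The atoms are the ordered set partitions with all blocks of size `d`: a larger block could be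
split. -/
theorem bot_covBy_iff (hd : 1 ≤ d) {ω : DivPartition n d} :
    (⊥ : Omega n d) ⋖ ω ↔ ∀ B ∈ ω.blocks, B.card = d := by
  constructor
  · intro h D hD
    by_contra hne
    have hlt : d < D.card := lt_of_le_of_ne (ω.le_card_of_mem hD) (Ne.symm hne)
    obtain ⟨B, hBD, hB⟩ := Finset.exists_subset_card_eq hlt.le
    obtain ⟨l₁, l₂, hω⟩ := List.append_of_mem hD
    have hu : B ∪ D \ B = D := Finset.union_sdiff_of_subset hBD
    have hc := Finset.card_sdiff_of_subset hBD
    rw [← hu] at hω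
    obtain ⟨ψ, hψ⟩ := ω.exists_split hω Finset.disjoint_sdiff
      (Finset.card_pos.1 (by omega)) (Finset.card_pos.1 (by omega)) (by rw [hB])
      (by rw [hc, hB]; exact Nat.dvd_sub (ω.dvd_card D hD) dvd_rfl)
    have hm := initialUnions_merge hψ hω
    exact h.2 (WithBot.bot_lt_coe ψ) (WithBot.coe_lt_coe.2 (covBy_of_erase hm.1 hm.2).lt)
  · intro h
    refine ⟨WithBot.bot_lt_coe ω, fun c hc hcω => ?_⟩
    obtain ⟨ψ, rfl⟩ := WithBot.ne_bot_iff_exists.1 hc.ne'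
    have h1 := Finset.card_lt_card (lt_iff.1 (WithBot.coe_lt_coe.1 hcω))
    have h2 := card_initialUnions ω
    have h3 := card_initialUnions ψ
    have := Nat.le_of_mul_le_mul_right (ψ.length_mul_le.trans_eq (length_mul_eq h).symm) hd
    omega

theorem length_eq_of_atom (hd : 1 ≤ d) {ω : DivPartition n d} (h : (⊥ : Omega n d) ⋖ ω) :
    ω.blocks.length = n / d :=
  (Nat.div_eq_of_eq_mul_left hd (length_mul_eq ((bot_covBy_iff hd).1 h)).symm).symm

end DivPartition

open DivPartition

variable {n d : ℕ}

/-- The rank function of `Omega n d`: an ordered set partition has `n / d + 1` minus its number of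
blocks as its rank. -/
def omegaRank : Omega n d → ℕ
  | ⊥ => 0
  | (ω : DivPartition n d) => n / d - ω.initialUnions.card

theorem omegaRank_bot : omegaRank (⊥ : Omega n d) = 0 := rfl

theorem omegaRank_coe (ω : DivPartition n d) :
    omegaRank (ω : Omega n d) = n / d - ω.initialUnions.card := rfl

theorem card_lt_div (hd : 1 ≤ d) (ω : DivPartition n d) : ω.initialUnions.card < n / d := by
  have h1 := card_initialUnions ω
  have h2 := (Nat.le_div_iff_mul_le hd).2 ω.length_mul_le
  omega

theorem omegaRank_strictMono (hd : 1 ≤ d) : StrictMono (omegaRank : Omega n d → ℕ) := by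
  intro x y hxy
  obtain ⟨ψ, rfl⟩ := WithBot.ne_bot_iff_exists.1 (bot_le.trans_lt hxy).ne'
  have h1 := card_lt_div hd ψ
  induction x using WithBot.recBotCoe with
  | bot => rw [omegaRank_bot, omegaRank_coe]; omega
  | coe ω =>
    have h2 := Finset.card_lt_card (lt_iff.1 (WithBot.coe_lt_coe.1 hxy))
    have h3 := card_lt_div hd ω
    rw [omegaRank_coe, omegaRank_coe]
    omega

theorem omegaRank_covBy (hd : 1 ≤ d) (x y : Omega n d) (hxy : x ⋖ y) :
    omegaRank y = omegaRank x + 1 := by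
  obtain ⟨ψ, rfl⟩ := WithBot.ne_bot_iff_exists.1 (bot_le.trans_lt hxy.lt).ne'
  have h1 := card_lt_div hd ψ
  induction x using WithBot.recBotCoe with
  | bot =>
    have h2 := card_initialUnions ψ
    rw [length_eq_of_atom hd hxy] at h2
    rw [omegaRank_bot, omegaRank_coe]
    omega
  | coe ω =>
    obtain ⟨v, hv, h2⟩ := exists_erase_of_covBy (WithBot.coe_covBy_coe.1 hxy)
    have h3 := Finset.card_erase_of_mem hv
    have h4 := card_lt_div hd ω
    have h5 := Finset.card_pos.2 ⟨v, hv⟩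
    rw [omegaRank_coe, omegaRank_coe, h2]
    omega

theorem isGradedPoset_omega (hd : 1 ≤ d) (hdn : d ∣ n) : IsGradedPoset (Omega n d) := by
  constructor
  · rcases Nat.eq_zero_or_pos n with rfl | hn
    · refine ⟨⊥, fun x => ?_⟩
      induction x using WithBot.recBotCoe with
      | bot => exact le_rfl
      | coe ω =>
        obtain ⟨B, hB⟩ := List.exists_mem_of_ne_nil _ ω.ne_nil
        obtain ⟨i, -⟩ := ω.block_nonempty B hB
        exact i.elim0
    · let t : DivPartition n d := ⟨[Finset.univ], by simp,
        by simpa using ⟨(⟨0, hn⟩ : Fin n), Finset.mem_univ _⟩, by simp, by simp, by simpa using hdn⟩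
      have ht : t.initialUnions = ∅ := by
        have := card_initialUnions t
        rw [← Finset.card_eq_zero]
        simpa [t] using this
      refine ⟨t, fun x => ?_⟩
      induction x using WithBot.recBotCoe with
      | bot => exact bot_le
      | coe ω => exact WithBot.coe_le_coe.2 (le_iff.2 (by simp [ht]))
  · have key : ∀ (x y : Omega n d) (c : List (Omega n d)), SatChain x y c →
        omegaRank y = omegaRank x + c.length := by
      intro x y c h
      induction c generalizing x with
      | nil => rw [satChain_nil.1 h]; rfl
      | cons a c ih =>
        obtain ⟨h1, h2⟩ := satChain_cons.1 h
        rw [ih a h2, omegaRank_covBy hd x a h1, List.length_cons]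
        omega
    intro y c c' h h'
    have h1 := key _ _ _ h
    have h2 := key _ _ _ h'
    omega

/-! ### Lexicographic comparison of blocks -/

theorem exists_first_difference {α β : Type*} {r : β → β → Prop} {f : α → β}
    (hf : Function.Injective f) {l m : List α} (hlen : l.length = m.length)
    (h : List.Lex r (l.map f) (m.map f)) :
    ∃ p B C s t, l = p ++ B :: s ∧ m = p ++ C :: t ∧ r (f B) (f C) := by
  induction l generalizing m with
  | nil =>
    obtain rfl := List.length_eq_zero_iff.1 hlen.symm
    cases h
  | cons B l ih =>
    cases m with
    | nil => simp at hlen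
    | cons C m =>
      rw [List.map_cons, List.map_cons, List.cons_lex_cons_iff] at h
      rcases h with h | ⟨hBC, h⟩
      · exact ⟨[], B, C, l, m, rfl, rfl, h⟩
      · obtain ⟨p, B', C', s, t, rfl, rfl, hr⟩ := ih (by simpa using hlen) h
        exact ⟨B :: p, B', C', s, t, rfl, by rw [hf hBC]; rfl, hr⟩

/-- For lists of one-letter words, comparing letter by letter is comparing word by word. -/
theorem lex_flatten {α : Type*} {r : α → α → Prop} {A B : List (List α)}
    (hA : ∀ l ∈ A, l.length = 1) (hB : ∀ l ∈ B, l.length = 1)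
    (h : List.Lex (List.Lex r) A B) : List.Lex r A.flatten B.flatten := by
  induction h with
  | nil =>
    obtain ⟨x, rfl⟩ := List.length_eq_one_iff.1 (hB _ List.mem_cons_self)
    exact .nil
  | rel h =>
    obtain ⟨x, rfl⟩ := List.length_eq_one_iff.1 (hA _ List.mem_cons_self)
    obtain ⟨y, rfl⟩ := List.length_eq_one_iff.1 (hB _ List.mem_cons_self)
    cases h with
    | rel h => exact .rel h
    | cons h => cases h
  | cons h ih =>
    obtain ⟨x, rfl⟩ := List.length_eq_one_iff.1 (hA _ List.mem_cons_self)
    exact .cons (ih (fun l hl => hA l (by simp [hl])) (fun l hl => hB l (by simp [hl])))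

section LinearOrder

variable {α : Type*} [LinearOrder α]

theorem sort_ge_injective : Function.Injective fun B : Finset α => B.sort (· ≥ ·) := by
  intro B C h
  rw [← Finset.sort_toFinset B (· ≥ ·), ← Finset.sort_toFinset C (· ≥ ·)]
  exact congrArg _ h

/-- A set `B` of the `k` smallest elements of a set precedes all other `k`-element subsets `C`. -/
theorem lex_sort_of_smallest {B C : Finset α} (hcard : B.card = C.card) (hne : B ≠ C)
    (h : ∀ x ∈ C, x ∉ B → ∀ y ∈ B, y < x) :
    List.Lex (· < ·) (B.sort (· ≥ ·)) (C.sort (· ≥ ·)) := by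
  obtain ⟨x, hxC, hxB⟩ : ∃ x ∈ C, x ∉ B := by
    by_contra! hsub
    exact hne (Finset.eq_of_subset_of_card_le hsub hcard.le).symm
  cases hB : B.sort (· ≥ ·) with
  | nil =>
    have h0 := Finset.length_sort (s := B) (· ≥ ·)
    rw [hB, List.length_nil, hcard] at h0
    exact absurd (Finset.card_eq_zero.1 h0.symm ▸ hxC) (Finset.notMem_empty x)
  | cons b l =>
    have hb : b ∈ B := (Finset.mem_sort (· ≥ ·)).1 (by rw [hB]; simp)
    have hx : x ∈ C.sort (· ≥ ·) := (Finset.mem_sort _).2 hxC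
    have hp := Finset.pairwise_sort C (· ≥ ·)
    cases hC : C.sort (· ≥ ·) with
    | nil => rw [hC] at hx; simp at hx
    | cons c m =>
      rw [hC] at hx hp
      refine .rel ((h x hxC hxB b hb).trans_le ?_)
      rcases List.mem_cons.1 hx with rfl | hx
      · exact le_rfl
      · exact (List.pairwise_cons.1 hp).1 x hx

theorem exists_smallest_subset (S : Finset α) {k : ℕ} (hk : k ≤ S.card) :
    ∃ T ⊆ S, T.card = k ∧ ∀ x ∈ T, ∀ z ∈ S, z ∉ T → x < z := by
  induction k with
  | zero => exact ⟨∅, by simp, rfl, by simp⟩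
  | succ k ih =>
    obtain ⟨T, hTS, hT, hlt⟩ := ih (by omega)
    have hne : (S \ T).Nonempty := by
      rw [← Finset.card_pos, Finset.card_sdiff_of_subset hTS]
      omega
    obtain ⟨hm1, hm2⟩ := Finset.mem_sdiff.1 ((S \ T).min'_mem hne)
    refine ⟨insert ((S \ T).min' hne) T, Finset.insert_subset hm1 hTS, ?_, ?_⟩
    · rw [Finset.card_insert_of_notMem hm2, hT]
    · intro x hx z hz hzT
      rw [Finset.mem_insert, not_or] at hzT
      rcases Finset.mem_insert.1 hx with rfl | hx
      · exact lt_of_le_of_ne (Finset.min'_le _ _ (Finset.mem_sdiff.2 ⟨hz, hzT.2⟩)) (Ne.symm hzT.1)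
      · exact hlt x hx z hz hzT.2

end LinearOrder

theorem decBlocks_coe (ω : DivPartition n d) :
    decBlocks (ω : Omega n d) = ω.blocks.map fun B => B.sort (· ≥ ·) := rfl

theorem decBlocks_injective : Function.Injective (decBlocks : Omega n d → _) := by
  intro x y h
  induction x using WithBot.recBotCoe with
  | bot =>
    induction y using WithBot.recBotCoe with
    | bot => rfl
    | coe ψ => exact absurd (List.map_eq_nil_iff.1 h.symm) ψ.ne_nil
  | coe ω =>
    induction y using WithBot.recBotCoe with
    | bot => exact absurd (List.map_eq_nil_iff.1 h) ω.ne_nil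
    | coe ψ =>
      rw [decBlocks_coe, decBlocks_coe] at h
      exact congrArg _ (DivPartition.ext (List.map_injective_iff.2 sort_ge_injective h))

/-! ### The atom ordering -/

/-- Suppose that any two adjacent blocks of `b` that are merged in `ψ` increase, and let `C` be a
block of `b`. Among the blocks of `b` after `C`, let `t` be those merged with `C` in `ψ`, so that a
block of `ψ` ends after `t`. Then all elements of blocks in `t` are larger than those of `C`. -/
theorem exists_block_segment {b ψ : DivPartition n d}
    (H : ∀ l₁ B C l₂, b.blocks = l₁ ++ B :: C :: l₂ → unionOf (l₁ ++ [B]) ∉ ψ.initialUnions →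
      ∀ x ∈ B, ∀ z ∈ C, x < z)
    (s p : List (Finset (Fin n))) (C : Finset (Fin n)) (hb : b.blocks = p ++ C :: s) :
    ∃ t u, s = t ++ u ∧ (u = [] ∨ unionOf (p ++ C :: t) ∈ ψ.initialUnions) ∧
      ∀ D ∈ t, ∀ x ∈ C, ∀ z ∈ D, x < z := by
  induction s generalizing p C with
  | nil => exact ⟨[], [], rfl, Or.inl rfl, by simp⟩
  | cons D s ih =>
    by_cases hv : unionOf (p ++ [C]) ∈ ψ.initialUnions
    · exact ⟨[], D :: s, rfl, Or.inr hv, by simp⟩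
    · have hCD := H p C D s hb hv
      obtain ⟨t, u, rfl, hu, hlt⟩ := ih (p ++ [C]) D (by simp [hb])
      refine ⟨D :: t, u, rfl, by simpa using hu, ?_⟩
      intro E hE x hx z hz
      rcases List.mem_cons.1 hE with rfl | hE
      · exact hCD x hx z hz
      · obtain ⟨w, hw⟩ := b.block_nonempty D (by simp [hb])
        exact (hCD x hx w hw).trans (hlt E hE w hw z hz)

/-- If an atom `b` is not the first one below `ψ`, it has a descent at adjacent blocks that are
merged in `ψ`. -/
theorem exists_descent (hd : 1 ≤ d) {a b ψ : DivPartition n d} (ha : (⊥ : Omega n d) ⋖ a)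
    (hb : (⊥ : Omega n d) ⋖ b) (hab : BlockLexLT (a : Omega n d) b) (haψ : a ≤ ψ) :
    ∃ l₁ B C l₂, b.blocks = l₁ ++ B :: C :: l₂ ∧ unionOf (l₁ ++ [B]) ∉ ψ.initialUnions ∧
      ¬ ∀ x ∈ B, ∀ z ∈ C, x < z := by
  by_contra! H
  obtain ⟨p, B, C, r, s, hpa, hpb, hBC⟩ := exists_first_difference sort_ge_injective
    ((length_eq_of_atom hd ha).trans (length_eq_of_atom hd hb).symm) hab
  obtain ⟨t, u, rfl, hu, hlt⟩ := exists_block_segment H s p C hpb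
  have hBa : B ∈ a.blocks := by simp [hpa]
  have hCb : C ∈ b.blocks := by simp [hpb]
  have hcard : C.card = B.card := by
    rw [(bot_covBy_iff hd).1 ha B hBa, (bot_covBy_iff hd).1 hb C hCb]
  have hsub : B ⊆ unionOf (p ++ C :: t) := by
    rcases hu with rfl | hu
    · have : unionOf (p ++ C :: t) = Finset.univ := by
        rw [← unionOf_blocks b, hpb, List.append_nil]
      rw [this]
      exact Finset.subset_univ B
    · obtain ⟨q, q', hq, -, -, hqT⟩ := mem_initialUnions.1 (le_iff.1 haψ hu)
      -- the segment `q` of `a` is strictly longer than `p`, so it contains `B`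
      have hpq : p <+: q := by
        refine prefix_of_unionOf_subset a.disjoint a.block_nonempty ⟨_, hpa.symm⟩ ⟨_, hq.symm⟩ ?_
        rw [hqT, unionOf_append]
        exact Finset.subset_union_left
      obtain ⟨q, rfl⟩ := hpq
      rw [hpa, List.append_assoc, List.append_cancel_left_eq] at hq
      cases q with
      | nil =>
        obtain ⟨x, hx⟩ := b.block_nonempty C hCb
        have hxp : x ∈ unionOf p := by
          rw [List.append_nil] at hqT
          rw [hqT]
          exact mem_unionOf.2 ⟨C, by simp, hx⟩
        obtain ⟨D, hD, hxD⟩ := mem_unionOf.1 hxp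
        have hdis := b.disjoint
        rw [hpb] at hdis
        have := (List.pairwise_append.1 hdis).2.2 D hD C (by simp)
        exact absurd hx (Finset.disjoint_left.1 this hxD)
      | cons D q =>
        rw [List.cons_append, List.cons.injEq] at hq
        rw [← hqT, hq.1]
        intro x hx
        exact mem_unionOf.2 ⟨D, by simp, hx⟩
  have hsmall : ∀ x ∈ B, x ∉ C → ∀ y ∈ C, y < x := by
    intro x hx hxC y hy
    obtain ⟨D, hD, hxD⟩ := mem_unionOf.1 (hsub hx)
    simp only [List.mem_append, List.mem_cons] at hD
    rcases hD with hD | rfl | hD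
    · have hdis := a.disjoint
      rw [hpa] at hdis
      have := (List.pairwise_append.1 hdis).2.2 D hD B (by simp)
      exact absurd hx (Finset.disjoint_left.1 this hxD)
    · exact absurd hxD hxC
    · exact hlt D hD y hy x hxD
  have hlt1 : B.sort (· ≥ ·) < C.sort (· ≥ ·) := hBC
  have hne : C ≠ B := by
    rintro rfl
    exact lt_irrefl _ hlt1
  have hlt2 : C.sort (· ≥ ·) < B.sort (· ≥ ·) := lex_sort_of_smallest hcard hne hsmall
  exact lt_asymm hlt1 hlt2

/-- Sorting the elements of two adjacent blocks with a descent gives an earlier atom. -/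
theorem exists_earlier_atom (hd : 1 ≤ d) {a b ψ : DivPartition n d} (ha : (⊥ : Omega n d) ⋖ a)
    (hb : (⊥ : Omega n d) ⋖ b) (hab : BlockLexLT (a : Omega n d) b) (haψ : a ≤ ψ) (hbψ : b ≤ ψ) :
    ∃ c χ : DivPartition n d, (⊥ : Omega n d) ⋖ c ∧ BlockLexLT (c : Omega n d) b ∧
      c ⋖ χ ∧ b ⋖ χ ∧ χ ≤ ψ := by
  obtain ⟨l₁, B, C, l₂, hbl, hv, hdesc⟩ := exists_descent hd ha hb hab haψ
  have hcards := (bot_covBy_iff hd).1 hb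
  have hB : B.card = d := hcards B (by simp [hbl])
  have hC : C.card = d := hcards C (by simp [hbl])
  have hdis : Disjoint B C := by
    have h := b.disjoint
    rw [hbl] at h
    exact (List.pairwise_cons.1 (List.pairwise_append.1 h).2.1).1 C (by simp)
  have hBC : (B ∪ C).card = d + d := by rw [Finset.card_union_of_disjoint hdis, hB, hC]
  obtain ⟨D, hDS, hD, hDlt⟩ := exists_smallest_subset (B ∪ C) (k := d) (by omega)
  have hE : ((B ∪ C) \ D).card = d := by rw [Finset.card_sdiff_of_subset hDS]; omega
  have hDB : D ≠ B := by
    rintro rfl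
    exact hdesc fun x hx z hz =>
      hDlt x hx z (Finset.mem_union_right _ hz) (Finset.disjoint_right.1 hdis hz)
  obtain ⟨χ, hχ⟩ := b.exists_merge hbl
  have hχ' : χ.blocks = l₁ ++ (D ∪ (B ∪ C) \ D) :: l₂ := by
    rw [hχ, Finset.union_sdiff_of_subset hDS]
  obtain ⟨c, hc⟩ := χ.exists_split hχ' Finset.disjoint_sdiff (Finset.card_pos.1 (by omega))
    (Finset.card_pos.1 (by omega)) (by rw [hD]) (by rw [hE])
  obtain ⟨hm1, hm2⟩ := initialUnions_merge hbl hχ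
  obtain ⟨hm3, hm4⟩ := initialUnions_merge hc hχ'
  refine ⟨c, χ, ?_, ?_, covBy_of_erase hm3 hm4, covBy_of_erase hm1 hm2, ?_⟩
  · refine (bot_covBy_iff hd).2 fun F hF => ?_
    rw [hc] at hF
    simp only [List.mem_append, List.mem_cons] at hF
    rcases hF with hF | rfl | rfl | hF
    · exact hcards F (by simp [hbl, hF])
    · exact hD
    · exact hE
    · exact hcards F (by simp [hbl, hF])
  · rw [BlockLexLT, decBlocks_coe, decBlocks_coe, hc, hbl, List.map_append, List.map_append]
    exact List.Lex.append_left _ (.rel (lex_sort_of_smallest (hD.trans hB.symm) hDB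
      fun x hx hxD y hy => hDlt y hy x (Finset.mem_union_left _ hx) hxD)) _
  · rw [le_iff, hm2]
    exact Finset.subset_erase.2 ⟨le_iff.1 hbψ, hv⟩

/-- If every ordering of the atoms of `[a, 1̂]` is a recursive atom ordering, for all atoms `a`
of `[x, 1̂]`, then the condition on covers of two atoms suffices. -/
theorem isRAO_of_upper {P : Type*} [PartialOrder P] [Finite P] {x : P} {L : List P}
    (nodup : L.Nodup) (mem_iff : ∀ a, a ∈ L ↔ x ⋖ a)
    (upper : ∀ a, x ⋖ a → ∀ L' : List P, L'.Nodup → (∀ b, b ∈ L' ↔ a ⋖ b) → IsRAO a L')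
    (common_cover : ∀ i k : Fin L.length, i < k → ∀ y, L.get i < y → L.get k < y →
      ∃ j, j < k ∧ ∃ z, L.get j ⋖ z ∧ L.get k ⋖ z ∧ z ≤ y) :
    IsRAO x L := by
  classical
  let covers : P → List P := fun a => (Set.toFinite {b | a ⋖ b}).toFinset.toList
  have hcov : ∀ a b, b ∈ covers a ↔ a ⋖ b := by simp [covers]
  let early : Fin L.length → P → Prop := fun j b => ∃ i, i < j ∧ L.get i ⋖ b
  refine .intro x L nodup mem_iff (fun j => (covers (L.get j)).filter fun b => early j b)
    (fun j => (covers (L.get j)).filter fun b => ¬ early j b) (fun j => ?_) ?_ ?_ common_cover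
  · refine upper _ ((mem_iff _).1 (L.get_mem j)) _ ?_ fun b => ?_
    · have hn : (covers (L.get j)).Nodup := Finset.nodup_toList _
      refine List.nodup_append.2 ⟨hn.filter _, hn.filter _, ?_⟩
      rintro b hb c hc rfl
      exact (of_decide_eq_true (List.mem_filter.1 hc).2) (of_decide_eq_true (List.mem_filter.1 hb).2)
    · simp only [List.mem_append, List.mem_filter, decide_eq_true_eq, ← and_or_left, em,
        and_true, hcov]
  · intro j b hb
    exact of_decide_eq_true (List.mem_filter.1 hb).2
  · intro j b hb
    exact of_decide_eq_true (List.mem_filter.1 hb).2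

/-- In a Boolean upper interval every ordering of the atoms is a recursive atom ordering. -/
theorem isRAO_coe (ω : DivPartition n d) (L : List (Omega n d)) (nodup : L.Nodup)
    (mem_iff : ∀ a, a ∈ L ↔ (ω : Omega n d) ⋖ a) : IsRAO (ω : Omega n d) L := by
  induction h : ω.initialUnions.card using Nat.strong_induction_on generalizing ω L with
  | _ m ih =>
    refine isRAO_of_upper nodup mem_iff ?_ ?_
    · intro a ha L' hL' hmem
      obtain ⟨ψ, rfl⟩ := WithBot.ne_bot_iff_exists.1 (bot_le.trans_lt ha.lt).ne'
      have hlt := Finset.card_lt_card (lt_iff.1 (WithBot.coe_lt_coe.1 ha.lt))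
      exact ih _ (h ▸ hlt) ψ L' hL' hmem rfl
    · intro i k hik y hiy hky
      have hi := (mem_iff _).1 (L.get_mem i)
      have hk := (mem_iff _).1 (L.get_mem k)
      have hne : L.get i ≠ L.get k := fun h => hik.ne (List.nodup_iff_injective_get.1 nodup h)
      refine ⟨i, hik, ?_⟩
      obtain ⟨a, ha⟩ := WithBot.ne_bot_iff_exists.1 (bot_le.trans_lt hi.lt).ne'
      obtain ⟨b, hb⟩ := WithBot.ne_bot_iff_exists.1 (bot_le.trans_lt hk.lt).ne'
      obtain ⟨ψ, rfl⟩ := WithBot.ne_bot_iff_exists.1 (bot_le.trans_lt hiy).ne'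
      rw [← ha] at hi hiy hne ⊢
      rw [← hb] at hk hky hne ⊢
      obtain ⟨u, hu, hau⟩ := exists_erase_of_covBy (WithBot.coe_covBy_coe.1 hi)
      obtain ⟨v, hv, hbv⟩ := exists_erase_of_covBy (WithBot.coe_covBy_coe.1 hk)
      have huv : u ≠ v := by
        rintro rfl
        exact hne (congrArg _ (initialUnions_injective (hau.trans hbv.symm)))
      have hva : v ∈ a.initialUnions := hau ▸ Finset.mem_erase.2 ⟨huv.symm, hv⟩
      have hub : u ∈ b.initialUnions := hbv ▸ Finset.mem_erase.2 ⟨huv, hu⟩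
      obtain ⟨χ, -, hχ⟩ := a.exists_initialUnions_eq (Finset.erase_subset v _)
      have hχ' : χ.initialUnions = b.initialUnions.erase u := by
        rw [hχ, hau, hbv, Finset.erase_right_comm]
      refine ⟨χ, WithBot.coe_covBy_coe.2 (covBy_of_erase hva hχ),
        WithBot.coe_covBy_coe.2 (covBy_of_erase hub hχ'), ?_⟩
      have h1 := le_iff.1 (WithBot.coe_le_coe.1 hiy.le)
      have h2 := le_iff.1 (WithBot.coe_le_coe.1 hky.le)
      rw [WithBot.coe_le_coe, le_iff, hχ]
      refine Finset.subset_erase.2 ⟨h1, fun h => ?_⟩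
      have := h2 h
      rw [hbv] at this
      exact Finset.notMem_erase v _ this

/-- The atoms of `Omega n d` in the order of `BlockLexLT` form a recursive atom ordering. -/
theorem isRAO_bot (hd : 1 ≤ d) {L : List (Omega n d)} (sorted : L.Pairwise BlockLexLT)
    (mem_iff : ∀ a, a ∈ L ↔ (⊥ : Omega n d) ⋖ a) : IsRAO (⊥ : Omega n d) L := by
  have hirr : ∀ a b : Omega n d, BlockLexLT a b → ¬ BlockLexLT b a := fun a b hab hba =>
    lt_asymm (show decBlocks a < decBlocks b from hab) hba
  have nodup : L.Nodup := sorted.imp fun {a b} hab => by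
    rintro rfl
    exact hirr _ _ hab hab
  refine isRAO_of_upper nodup mem_iff ?_ ?_
  · intro a ha L' hL' hmem
    obtain ⟨ω, rfl⟩ := WithBot.ne_bot_iff_exists.1 ha.lt.ne'
    exact isRAO_coe ω L' hL' hmem
  · intro i k hik y hiy hky
    have hi := (mem_iff _).1 (L.get_mem i)
    have hk := (mem_iff _).1 (L.get_mem k)
    have hlt : BlockLexLT (L.get i) (L.get k) := List.pairwise_iff_get.1 sorted i k hik
    obtain ⟨a, ha⟩ := WithBot.ne_bot_iff_exists.1 hi.lt.ne'
    obtain ⟨b, hb⟩ := WithBot.ne_bot_iff_exists.1 hk.lt.ne'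
    obtain ⟨ψ, rfl⟩ := WithBot.ne_bot_iff_exists.1 (bot_le.trans_lt hiy).ne'
    rw [← ha] at hi hlt hiy
    rw [← hb] at hk hlt hky
    obtain ⟨c, χ, hc, hcb, hcχ, hbχ, hχ⟩ := exists_earlier_atom hd hi hk hlt
      (WithBot.coe_le_coe.1 hiy.le) (WithBot.coe_le_coe.1 hky.le)
    obtain ⟨j, hj⟩ := List.mem_iff_get.1 ((mem_iff _).2 hc)
    refine ⟨j, ?_, χ, ?_, ?_, WithBot.coe_le_coe.2 hχ⟩
    · by_contra hkj
      rw [hb, ← hj] at hcb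
      rcases (not_lt.1 hkj).eq_or_lt with rfl | hkj
      · exact hirr _ _ hcb hcb
      · exact hirr _ _ hcb (List.pairwise_iff_get.1 sorted k j hkj)
    · rw [hj]
      exact WithBot.coe_covBy_coe.2 hcχ
    · rw [← hb]
      exact WithBot.coe_covBy_coe.2 hbχ

theorem exists_sorted_atoms (n d : ℕ) :
    ∃ L : List (Omega n d), L.Pairwise BlockLexLT ∧ ∀ a, a ∈ L ↔ (⊥ : Omega n d) ⋖ a := by
  classical
  let s : Finset (Omega n d) := (Set.toFinite {a : Omega n d | ⊥ ⋖ a}).toFinset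
  let r : Omega n d → Omega n d → Prop := fun a b => decBlocks a ≤ decBlocks b
  have : IsTrans (Omega n d) r := ⟨fun _ _ _ h h' => le_trans h h'⟩
  have : Std.Total r := ⟨fun a b => le_total (decBlocks a) (decBlocks b)⟩
  have : Std.Antisymm r := ⟨fun _ _ h h' => decBlocks_injective (le_antisymm h h')⟩
  refine ⟨s.sort r, ?_, fun a => by simp [s]⟩
  refine ((Finset.pairwise_sort s r).and (Finset.sort_nodup s r)).imp ?_
  rintro a b ⟨hab, hne⟩
  exact lt_of_le_of_ne hab fun h => hne (decBlocks_injective h)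

theorem wordLexLT_of_atoms {a b : Omega n 1} (ha : ⊥ ⋖ a) (hb : ⊥ ⋖ b) (h : BlockLexLT a b) :
    WordLexLT a b := by
  have key : ∀ x : Omega n 1, ⊥ ⋖ x → ∀ l ∈ decBlocks x, l.length = 1 := by
    intro x hx l hl
    obtain ⟨ω, rfl⟩ := WithBot.ne_bot_iff_exists.1 hx.lt.ne'
    rw [decBlocks_coe] at hl
    obtain ⟨B, hB, rfl⟩ := List.mem_map.1 hl
    rw [Finset.length_sort, (bot_covBy_iff le_rfl).1 hx B hB]
  exact lex_flatten (key a ha) (key b hb) h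

end OrdPart

theorem theorem2p5 (n d : ℕ) (hd : 1 ≤ d) (hdn : d ∣ n) :
    (∃ L : List (OrdPart.Omega n d),
      OrdPart.IsRAO ⊥ L ∧
      L.Pairwise OrdPart.BlockLexLT ∧
      (d = 1 → L.Pairwise OrdPart.WordLexLT)) ∧
    OrdPart.CLShellable (OrdPart.Omega n d) ∧
    ∀ (R : Type*) [CommRing R], OrdPart.CohenMacaulay R (OrdPart.Omega n d) := by
  obtain ⟨L, sorted, mem_iff⟩ := OrdPart.exists_sorted_atoms n d
  have hL := OrdPart.isRAO_bot hd sorted mem_iff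
  have hg := OrdPart.isGradedPoset_omega hd hdn
  refine ⟨⟨L, hL, sorted, ?_⟩, hL.clShellable hg, fun R _ =>
    hL.cohenMacaulay R (OrdPart.omegaRank_strictMono hd) (OrdPart.omegaRank_covBy hd) hg⟩
  rintro rfl
  exact sorted.imp_of_mem fun ha hb hab =>
    OrdPart.wordLexLT_of_atoms ((mem_iff _).1 ha) ((mem_iff _).1 hb) hab
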